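/- Let $G$ be a finite connected simple graph with $n$ vertices, $E(G)$ its edge set and $D(G)$ its set of arcs (the ordered pairs $(u,v)$, $(v,u)$ with $uv\in E(G)$). Let $w$ be a symmetric complex weight on $G$, with weighted matrix $\mathbf W=(w(u,v))$: $w(u,v)=w(v,u)\in\mathbb C$, and $w(u,v)=0$ if $(u,v)\notin D(G)$. Put $w(G)=\sum_{uv\in E(G)}w(u,v)$, $d^w_v=\sum_{u}w(v,u)$, $\mathbf D_w=\operatorname{diag}(d^w_v)$, $\mathbf L=\mathbf D_w-\mathbf W$, and $\kappa_w(G)=\sum_T\prod_{e\in E(T)}w(e)$, where $T$ runs over the spanning trees of $G$. For distinct vertices $p,q$ let $r_{pq}=\det(\mathbf L^{(pq)})/\kappa_w(G)$, where $\mathbf L^{(pq)}$ is $\mathbf L$ with the rows and columns $p,q$ deleted, and let \[ Kf^z_w(G,t)=\sum_{\{p,q\},\,p\neq q}(d^w_p t-2)(d^w_q t-2)\,r_{pq}, \] the sum running over unordered pairs of vertices. Let $\Gamma$ be a finite group and $\alpha:D(G)\to\Gamma$ an ordinary voltage assignment, i.e. $\alpha(v,u)=\alpha(u,v)^{-1}$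 for $(u,v)\in D(G)$. The $\Gamma$-covering $G^\alpha$ has vertex set $V(G)\times\Gamma$, and $((u,g),(v,h))$ is an arc of it if and only if $(u,v)\in D(G)$ and $h=g\,\alpha(u,v)$; the derived weight is $\tilde w((u,g),(v,h))=w(u,v)$ on the arcs of $G^\alpha$ and $0$ otherwise. For $g\in\Gamma$ let $\mathbf W_g$ be the matrix with $(u,v)$ entry $w(u,v)$ if $(u,v)\in D(G)$ and $\alpha(u,v)=g$, and $0$ otherwise. Let $\rho_1=1,\rho_2,\dots,\rho_k$ be all the inequivalent irreducible complex (matrix) representations of $\Gamma$, let $f_i$ be the degree of $\rho_i$, and for $2\le i\le k$ set \[ K_i(u,t)=\det\Bigl(\mathbf I_{nf_i}-t\sum_{g\in\Gamma}\rho_i(g)\otimes\mathbf W_g+(1-u)t^2\,\mathbf I_{f_i}\otimes(\mathbf D_w-(1-u)\mathbf I_n)\Bigr). \] Suppose that $G^\alpha$ is connected and that $\kappa_{\tilde w}(G^\alpha)\neq0$, and let $t\in\mathbb C$, $t\neq0$. Then $\kappa_w(G)\ne0$ and $K_i(1-1/t,t)\neq0$ for $2\le i\le k$, and the following three formulas hold,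 where $\partial\log K_i$ denotes the logarithmic derivative $\partial K_i/K_i$: \begin{enumerate} \item \[ Kf^z_{\tilde w}(G^\alpha,t)=|\Gamma|\,Kf^z_w(G,t)-2|\Gamma|(w(G)t-n)\Bigl((|\Gamma|-1)nt-t^2\sum_{i=2}^k f_i\,\frac{\partial}{\partial t}\log K_i(u,t)\Big|_{(u,t)=(1-1/t,\,t)}\Bigr); \] \item \[ Kf^z_{\tilde w}(G^\alpha,t)=|\Gamma|\,Kf^z_w(G,t)+|\Gamma|(n-w(G)t)\Bigl((|\Gamma|-1)nt-t^2\sum_{i=2}^k f_i\,\frac{\partial}{\partial t}\log K_i(u,t)\Big|_{(1-1/t,\,t)}+\sum_{i=2}^k f_i\,\frac{\partial}{\partial u}\log K_i(u,t)\Big|_{(1-1/t,\,t)}\Bigr); \] \item \[ Kf^z_{\tilde w}(G^\alpha,t)=|\Gamma|\,Kf^z_w(G,t)-2|\Gamma|(w(G)t-n)\sum_{i=2}^k f_i\,\frac{\partial}{\partial u}\log K_i(u,t)\Big|_{(1-1/t,\,t)}. \] \end{enumerate} -/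

import Mathlib

open scoped Kronecker

noncomputable section

namespace WeightedCover

/-- A symmetric complex weight on the graph `G`, given by its weighted matrix: the `(u, v)` entry is
the weight of the arc `(u, v)`, and it is `0` when `(u, v)` is not an arc of `G`. -/
structure SymmWeight {V : Type*} (G : SimpleGraph V) where
  W : Matrix V V ℂ
  symm : ∀ u v, W u v = W v u
  eq_zero : ∀ u v, ¬ G.Adj u v → W u v = 0

namespace SymmWeight

variable {V : Type*} {G : SimpleGraph V} (w : SymmWeight G)

/-- The weight of an unoriented edge. -/
def edge : Sym2 V → ℂ :=
  Sym2.lift ⟨w.W, w.symm⟩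

variable [Fintype V]

open scoped Classical in
/-- `w(G)`, the sum of the weights of the edges of `G`. -/
def total : ℂ :=
  ∑ e ∈ G.edgeFinset, w.edge e

/-- The weighted degree `d^w_v`: the sum of the weights of the arcs with origin `v`. -/
def degree (v : V) : ℂ :=
  ∑ u, w.W v u

variable [DecidableEq V]

open scoped Classical in
/-- The weighted complexity `κ_w(G)`: the sum over the spanning trees `T` of `G` of the product of
the weights of the edges of `T`. -/
def complexity : ℂ :=
  ∑ T : SimpleGraph V with T ≤ G ∧ T.IsTree, ∏ e ∈ T.edgeFinset, w.edge e

/-- The diagonal matrix `D_w` of the weighted degrees. -/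
def degMatrix : Matrix V V ℂ :=
  Matrix.diagonal w.degree

/-- The weighted Laplacian `L = D_w - W`. -/
def laplacian : Matrix V V ℂ :=
  w.degMatrix - w.W

/-- The weighted resistance distance: for `p ≠ q`, the determinant of the Laplacian with the rows and
columns `p`, `q` deleted, divided by the weighted complexity; `r_{pp} = 0`. -/
def resistance (p q : V) : ℂ :=
  if p = q then 0
  else (w.laplacian.submatrix (Subtype.val : {x : V // x ≠ p ∧ x ≠ q} → V)
    (Subtype.val : {x : V // x ≠ p ∧ x ≠ q} → V)).det / w.complexity

/-- The weighted Kirchhoff index function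
`Kf^z_w(G,t) = ∑_{p<q} (d^w_p t - 2) (d^w_q t - 2) r_{pq}`. The sum over unordered pairs is written
as half of the sum over ordered pairs; the diagonal contributes `0`. -/
def kirchhoff (t : ℂ) : ℂ :=
  (∑ p, ∑ q, (w.degree p * t - 2) * (w.degree q * t - 2) * w.resistance p q) / 2

end SymmWeight

/-- An ordinary voltage assignment on `G` with values in `Γ`. Only the values on the arcs of `G` are
ever used. -/
structure Voltage {V : Type*} (G : SimpleGraph V) (Γ : Type*) [Group Γ] where
  val : V → V → Γ
  inv : ∀ u v, G.Adj u v → val v u = (val u v)⁻¹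

namespace Voltage

variable {V Γ : Type*} [Group Γ] {G : SimpleGraph V} (α : Voltage G Γ)

/-- The derived graph `G^α`, i.e. the `Γ`-covering of `G`. -/
def derived : SimpleGraph (V × Γ) where
  Adj x y := G.Adj x.1 y.1 ∧ y.2 = x.2 * α.val x.1 y.1
  symm := ⟨fun x y h => ⟨h.1.symm, by rw [α.inv _ _ h.1, h.2, mul_inv_cancel_right]⟩⟩
  loopless := ⟨fun x h => G.irrefl h.1⟩

open scoped Classical in
/-- The weight on `G^α` derived from the weight `w` on `G`. -/
def derivedWeight (w : SymmWeight G) : SymmWeight α.derived where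
  W x y := if G.Adj x.1 y.1 ∧ y.2 = x.2 * α.val x.1 y.1 then w.W x.1 y.1 else 0
  symm x y := by
    have h : α.derived.Adj x y ↔ α.derived.Adj y x := ⟨fun h => h.symm, fun h => h.symm⟩
    simp only [derived] at h
    rw [w.symm x.1 y.1]
    exact if_congr h rfl rfl
  eq_zero x y h := if_neg h

open scoped Classical in
/-- The matrix `W_g`: the weighted matrix restricted to the arcs of voltage `g`. -/
def part (w : SymmWeight G) (g : Γ) : Matrix V V ℂ :=
  fun u v => if α.val u v = g ∧ G.Adj u v then w.W u v else 0

/-- For a matrix representation `ρ` of degree `d`, the determinant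
`det (I - t ∑_g ρ(g) ⊗ W_g + (1-u) t² I_d ⊗ (D_w - (1-u) I_n))`. -/
def repDet [Fintype V] [DecidableEq V] [Fintype Γ] (w : SymmWeight G) {d : ℕ}
    (ρ : Γ →* Matrix (Fin d) (Fin d) ℂ) (u t : ℂ) : ℂ :=
  (1 - t • (∑ g : Γ, ρ g ⊗ₖ α.part w g)
    + ((1 - u) * t ^ 2) •
      ((1 : Matrix (Fin d) (Fin d) ℂ) ⊗ₖ (w.degMatrix - (1 - u) • (1 : Matrix V V ℂ)))).det

end Voltage

/-- The representation on `ℂ^d` given by a matrix representation. -/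
def toRep {Γ : Type*} [Group Γ] {d : ℕ} (ρ : Γ →* Matrix (Fin d) (Fin d) ℂ) :
    Representation ℂ Γ (Fin d → ℂ) :=
  (Matrix.toLinAlgEquiv' : Matrix (Fin d) (Fin d) ℂ ≃ₐ[ℂ] _).toAlgHom.toMonoidHom.comp ρ

/-- `ρ` lists the complex irreducible representations of `Γ`, each equivalence class exactly once. -/
structure IsAllIrreps {Γ : Type*} [Group Γ] {ι : Type*} {f : ι → ℕ}
    (ρ : (i : ι) → Γ →* Matrix (Fin (f i)) (Fin (f i)) ℂ) : Prop where
  irreducible : ∀ i, (toRep (ρ i)).IsIrreducible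
  inequivalent : ∀ i j, Nonempty ((toRep (ρ i)).Equiv (toRep (ρ j))) → i = j
  complete : ∀ (d : ℕ) (σ : Γ →* Matrix (Fin d) (Fin d) ℂ), (toRep σ).IsIrreducible →
    ∃ i, Nonempty ((toRep σ).Equiv (toRep (ρ i)))

end WeightedCover

end

/-! Put `a v = d_v t - 2` and `P(x) = det(L + x diag a)`. Expanding in principal minors gives `P(0)
= det L = 0`. By the matrix-tree theorem the coefficient of `x` is `κ · ∑ a = 2(w(G)t - n) κ`. The
coefficient of `x²` is `κ · Kf`, since the two-vertex-deleted minors are `κ r_pq`.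

Weighted degrees lift to the covering, so its perturbed Laplacian is a group matrix with entries
depending on `g⁻¹h`. The regular representation decomposes it, and the polynomial of the covering
becomes `P · ∏ P_i ^ f_i`, where `P_i(x) = det(L_i + x diag a)` and `L_i = I ⊗ D_w - ∑ ρ_i(g) ⊗ W_g`
(`IsAllIrreps.minorPoly_laplacian_derivedWeight`). For `a = 1`, the linear coefficients give `|Γ| κ̃
= κ ∏ (det L_i)^{f_i}`, hence the nonvanishing claims. For `a = d t - 2`, the quadratic coefficients
give `Kf̃ = |Γ| Kf + 2|Γ|(w(G)t - n) ∑ f_i c_i`, with `c_i = P_i'(0)/P_i(0)`.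

It remains to read `c_i` off `K_i`. At `u = 1 - 1/t` the matrix inside `K_i` is `t L_i`, its
`u`-derivative is `-t diag a`, and its `t`-derivative is `L_i + t⁻¹ diag a`. So `∂_u log K_i = -c_i`
and `t² ∂_t log K_i = f_i n t + c_i`. With `∑ f_i² = |Γ|` this yields (1) and (3), and (2) is their
average. -/

noncomputable section

namespace WeightedCover

/-! ### Parent functions and the weighted matrix-tree theorem -/

section MatrixTree

variable {V : Type*} {p : V}

/-- `φ` assigns to every vertex other than `p` a parent, so that all vertices descend from `p`. -/
def IsParentFun (φ : {x : V // x ≠ p} → V) : Prop :=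
  ∃ d : V → ℕ, ∀ v : {x : V // x ≠ p}, d (φ v) < d v

/-- The graph whose edges join the vertices other than `p` to their parents. -/
def parentGraph (φ : {x : V // x ≠ p} → V) : SimpleGraph V :=
  SimpleGraph.fromEdgeSet (Set.range fun v : {x : V // x ≠ p} => s((v : V), φ v))

theorem IsParentFun.ne {φ : {x : V // x ≠ p} → V} (h : IsParentFun φ) (v : {x : V // x ≠ p}) :
    (v : V) ≠ φ v := by
  obtain ⟨d, hd⟩ := h
  intro hv
  have := hd v
  rw [← hv] at this
  exact lt_irrefl _ this

theorem IsParentFun.adj {φ : {x : V // x ≠ p} → V} (h : IsParentFun φ) (v : {x : V // x ≠ p}) :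
    (parentGraph φ).Adj v (φ v) := by
  rw [parentGraph, SimpleGraph.fromEdgeSet_adj]
  exact ⟨⟨v, rfl⟩, h.ne v⟩

theorem IsParentFun.edgeSet {φ : {x : V // x ≠ p} → V} (h : IsParentFun φ) :
    (parentGraph φ).edgeSet = Set.range fun v : {x : V // x ≠ p} => s((v : V), φ v) := by
  rw [parentGraph, SimpleGraph.edgeSet_fromEdgeSet]
  refine sdiff_eq_left.mpr (Set.disjoint_left.mpr ?_)
  rintro _ ⟨v, rfl⟩ hv
  exact h.ne v (by simpa using hv)

theorem IsParentFun.edge_injective {φ : {x : V // x ≠ p} → V} (h : IsParentFun φ) :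
    Function.Injective fun v : {x : V // x ≠ p} => s((v : V), φ v) := by
  obtain ⟨d, hd⟩ := h
  intro v x hvx
  rcases Sym2.eq_iff.mp hvx with ⟨h1, -⟩ | ⟨h1, h2⟩
  · exact Subtype.ext h1
  · have hv := hd v
    have hx := hd x
    rw [h2] at hv
    rw [← h1] at hx
    exact absurd (hv.trans hx) (lt_irrefl _)

theorem IsParentFun.connected {φ : {x : V // x ≠ p} → V} (h : IsParentFun φ) :
    (parentGraph φ).Connected := by
  have key : ∀ v, (parentGraph φ).Reachable v p := by
    obtain ⟨d, hd⟩ := id h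
    intro v
    induction hn : d v using Nat.strong_induction_on generalizing v with
    | _ n ih =>
      by_cases hv : v = p
      · rw [hv]
      · exact (h.adj ⟨v, hv⟩).reachable.trans (ih _ (hn ▸ hd ⟨v, hv⟩) _ rfl)
  exact (SimpleGraph.connected_iff _).mpr ⟨fun u v => (key u).trans (key v).symm, ⟨p⟩⟩

theorem IsParentFun.isTree [Finite V] {φ : {x : V // x ≠ p} → V} (h : IsParentFun φ) :
    (parentGraph φ).IsTree := by
  classical
  have := Fintype.ofFinite V
  refine SimpleGraph.isTree_iff_connected_and_card.mpr ⟨h.connected, ?_⟩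
  rw [h.edgeSet, Nat.card_range_of_injective h.edge_injective, Nat.card_eq_fintype_card,
    Nat.card_eq_fintype_card, Fintype.card_subtype_compl, Fintype.card_subtype_eq]
  have := Fintype.card_pos_iff.mpr ⟨p⟩
  omega

/-- Induction on the depth for `ψ`. The edge from `v` to `ψ v` is also an edge of `φ`; if it is not
the parent edge of `v`, then `φ` sends `ψ v` to `v`. By induction `ψ` does so too, against the
descent. -/
theorem IsParentFun.eq_of_parentGraph_eq {φ ψ : {x : V // x ≠ p} → V} (hφ : IsParentFun φ)
    (hψ : IsParentFun ψ) (h : parentGraph φ = parentGraph ψ) : φ = ψ := by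
  obtain ⟨d, hd⟩ := id hψ
  have key : ∀ n, ∀ v : {x : V // x ≠ p}, d v = n → φ v = ψ v := by
    intro n
    induction n using Nat.strong_induction_on with
    | _ n ih =>
      intro v hv
      by_contra hne
      have he : s((v : V), ψ v) ∈ (parentGraph φ).edgeSet := by
        rw [h, hψ.edgeSet]
        exact ⟨v, rfl⟩
      rw [hφ.edgeSet] at he
      obtain ⟨x, hx⟩ := he
      rcases Sym2.eq_iff.mp hx with ⟨h1, h2⟩ | ⟨h1, h2⟩
      · rw [Subtype.ext h1] at h2
        exact hne h2
      · have hlt := hd v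
        rw [← h1] at hlt
        have h3 := ih _ (hv ▸ hlt) x rfl
        have h4 := hd x
        rw [← h3, h2] at h4
        exact lt_asymm hlt h4
  funext v
  exact key _ v rfl

/-- The parent of `v` is the next vertex on a shortest walk to `p`. The resulting graph is a
connected subgraph of `T`, and a tree is minimal among connected graphs. -/
theorem _root_.SimpleGraph.IsTree.exists_parentGraph_eq {T : SimpleGraph V} (hT : T.IsTree)
    (p : V) : ∃ φ : {x : V // x ≠ p} → V, IsParentFun φ ∧ parentGraph φ = T := by
  have hstep : ∀ v : {x : V // x ≠ p}, ∃ u, T.Adj v u ∧ T.dist u p < T.dist v p := by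
    rintro ⟨v, hv⟩
    obtain ⟨q, hq⟩ := hT.connected.exists_walk_length_eq_dist v p
    cases q with
    | nil => exact absurd rfl hv
    | cons hadj q =>
      refine ⟨_, hadj, ?_⟩
      have := SimpleGraph.dist_le q
      rw [SimpleGraph.Walk.length_cons] at hq
      dsimp only
      omega
  choose φ hadj hdist using hstep
  have hφ : IsParentFun φ := ⟨fun v => T.dist v p, hdist⟩
  refine ⟨φ, hφ, le_antisymm ?_ ?_⟩
  · rw [← SimpleGraph.edgeSet_subset_edgeSet, hφ.edgeSet]
    rintro _ ⟨v, rfl⟩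
    exact hadj v
  · refine (SimpleGraph.isTree_iff_minimal_connected.mp hT).2 hφ.connected ?_
    rw [← SimpleGraph.edgeSet_subset_edgeSet, hφ.edgeSet]
    rintro _ ⟨v, rfl⟩
    exact hadj v

variable [Fintype V] [DecidableEq V]

/-- The rows of the incidence matrix of a parent function, with the column of the root deleted. -/
def incidence (φ : {x : V // x ≠ p} → V) : Matrix {x : V // x ≠ p} {x : V // x ≠ p} ℂ :=
  fun v x => (if v = x then 1 else 0) - (if φ v = x then 1 else 0)

/-- Ordered by depth, the matrix is block triangular with identity diagonal blocks, because a parent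
is strictly less deep than its child. -/
theorem IsParentFun.det_incidence {φ : {x : V // x ≠ p} → V} (h : IsParentFun φ) :
    (incidence φ).det = 1 := by
  obtain ⟨d, hd⟩ := h
  have hb : (incidence φ).BlockTriangular fun v => OrderDual.toDual (d v) := by
    intro v x hvx
    have hvx : d v < d x := hvx
    have h1 : v ≠ x := by
      rintro rfl
      exact lt_irrefl _ hvx
    have h2 : φ v ≠ x := fun h2 => by
      have := hd v
      rw [h2] at this
      exact lt_asymm this hvx
    simp [incidence, h1, h2]
  rw [hb.det]
  refine Finset.prod_eq_one fun a _ => ?_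
  suffices h1 : (incidence φ).toSquareBlock (fun v => OrderDual.toDual (d v)) a = 1 by
    rw [h1, Matrix.det_one]
  ext ⟨v, hv⟩ ⟨x, hx⟩
  have h2 : φ v ≠ x := fun h2 => by
    have := hd v
    have hvx : d v = d x := OrderDual.toDual.injective (hv.trans hx.symm)
    rw [h2, hvx] at this
    exact lt_irrefl _ this
  simp [Matrix.toSquareBlock_def, incidence, h2, Matrix.one_apply]

/-- The indicator of the vertices whose iterated parents never reach `p` lies in the kernel. So it
vanishes, and the number of steps to `p` is a depth function. -/
theorem isParentFun_of_det_incidence_ne_zero {φ : {x : V // x ≠ p} → V}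
    (h : (incidence φ).det ≠ 0) : IsParentFun φ := by
  classical
  let ψ : V → V := fun v => if hv : v = p then p else φ ⟨v, hv⟩
  have hψ : ∀ v : {x : V // x ≠ p}, ψ v = φ v := fun v => dif_neg v.2
  let c : V → ℂ := fun v => if ∃ k, ψ^[k] v = p then 0 else 1
  have hcp : c p = 0 := if_pos ⟨0, rfl⟩
  have hcψ : ∀ v, v ≠ p → c (ψ v) = c v := by
    intro v hv
    refine if_congr ⟨?_, ?_⟩ rfl rfl
    · rintro ⟨k, hk⟩
      exact ⟨k + 1, hk⟩
    · rintro ⟨k, hk⟩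
      cases k with
      | zero => exact absurd hk hv
      | succ k => exact ⟨k, hk⟩
  have hker : (incidence φ).mulVec (fun x => c x) = 0 := by
    funext v
    have h1 : ∑ x : {x : V // x ≠ p}, (if φ v = x then (1 : ℂ) else 0) * c x = c (φ v) := by
      by_cases hv : φ v = p
      · rw [hv, hcp]
        refine Finset.sum_eq_zero fun x _ => ?_
        rw [if_neg fun hx => x.2 hx.symm, zero_mul]
      · rw [Finset.sum_eq_single ⟨φ v, hv⟩]
        · simp
        · intro x _ hx
          rw [if_neg fun h => hx (Subtype.ext h.symm), zero_mul]
        · simp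
    simp only [Matrix.mulVec, dotProduct, incidence, sub_mul, Finset.sum_sub_distrib, h1]
    rw [← hψ v, hcψ v v.2]
    simp
  have hc := Matrix.eq_zero_of_mulVec_eq_zero h hker
  have hreach : ∀ v, ∃ k, ψ^[k] v = p := by
    intro v
    by_cases hv : v = p
    · exact ⟨0, hv⟩
    · by_contra hk
      have := congrFun hc ⟨v, hv⟩
      simp [c, hk] at this
  refine ⟨fun v => Nat.find (hreach v), fun v => ?_⟩
  dsimp only
  have hfind := Nat.find_spec (hreach v)
  rcases hm : Nat.find (hreach v) with _ | m
  · rw [hm] at hfind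
    exact absurd hfind v.2
  · rw [hm] at hfind
    refine Nat.lt_succ_of_le (Nat.find_min' _ ?_)
    rw [← hψ v]
    exact hfind

variable {G : SimpleGraph V}

/-- Row `v` of the reduced Laplacian is `∑_u w(v,u) (e_v - e_u)`, with `e_p` read as `0`.
Multilinearity turns the choice of one `u` per row into a function `φ`. -/
theorem SymmWeight.det_laplacian_eq_sum (w : SymmWeight G) (p : V) :
    (w.laplacian.submatrix (Subtype.val : {x : V // x ≠ p} → V) Subtype.val).det =
      ∑ φ : {x : V // x ≠ p} → V, (∏ v : {x : V // x ≠ p}, w.W v (φ v)) * (incidence φ).det := by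
  have hrow : w.laplacian.submatrix (Subtype.val : {x : V // x ≠ p} → V) Subtype.val =
      fun v : {x : V // x ≠ p} => ∑ u, w.W v u • fun x : {x : V // x ≠ p} =>
        ((if v = x then 1 else 0) - (if u = (x : V) then 1 else 0) : ℂ) := by
    funext v x
    rw [Finset.sum_apply]
    simp only [Pi.smul_apply, smul_eq_mul, mul_sub, Finset.sum_sub_distrib,
      mul_ite, mul_one, mul_zero, Finset.sum_ite_eq', Finset.mem_univ, if_true]
    simp [SymmWeight.laplacian, SymmWeight.degMatrix, Matrix.diagonal_apply, SymmWeight.degree,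
      Subtype.ext_iff]
  rw [hrow]
  refine (MultilinearMap.map_sum (Matrix.detRowAlternating
    (R := ℂ) (n := {x : V // x ≠ p})).toMultilinearMap _).trans ?_
  refine Finset.sum_congr rfl fun φ _ => ?_
  exact MultilinearMap.map_smul_univ _ _ _

/-- The weighted matrix-tree theorem. -/
theorem SymmWeight.det_laplacian_eq_complexity (w : SymmWeight G) (p : V) :
    (w.laplacian.submatrix (Subtype.val : {x : V // x ≠ p} → V) Subtype.val).det =
      w.complexity := by
  classical
  rw [w.det_laplacian_eq_sum p, SymmWeight.complexity]
  rw [← Finset.sum_subset (Finset.subset_univ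
    (Finset.univ.filter fun φ : {x : V // x ≠ p} → V => IsParentFun φ ∧ ∀ v : {x : V // x ≠ p}, G.Adj v (φ v)))]
  · refine Finset.sum_bij (fun φ _ => parentGraph φ) ?_ ?_ ?_ ?_
    · intro φ hφ
      simp only [Finset.mem_filter, Finset.mem_univ, true_and] at hφ ⊢
      refine ⟨?_, hφ.1.isTree⟩
      rw [← SimpleGraph.edgeSet_subset_edgeSet, hφ.1.edgeSet]
      rintro _ ⟨v, rfl⟩
      exact hφ.2 v
    · intro φ hφ ψ hψ h
      simp only [Finset.mem_filter, Finset.mem_univ, true_and] at hφ hψ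
      exact hφ.1.eq_of_parentGraph_eq hψ.1 h
    · intro T hT
      simp only [Finset.mem_filter, Finset.mem_univ, true_and] at hT
      obtain ⟨φ, hφ, rfl⟩ := hT.2.exists_parentGraph_eq p
      exact ⟨φ, Finset.mem_filter.mpr ⟨Finset.mem_univ _, hφ, fun v => hT.1 (hφ.adj v)⟩, rfl⟩
    · intro φ hφ
      simp only [Finset.mem_filter, Finset.mem_univ, true_and] at hφ
      rw [hφ.1.det_incidence, mul_one]
      have himage : (parentGraph φ).edgeFinset =
          Finset.univ.image fun v : {x : V // x ≠ p} => s((v : V), φ v) := by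
        ext e
        rw [SimpleGraph.mem_edgeFinset, hφ.1.edgeSet]
        simp
      rw [himage, Finset.prod_image fun _ _ _ _ h => hφ.1.edge_injective h]
      rfl
  · intro φ _ hφ
    simp only [Finset.mem_filter, Finset.mem_univ, true_and, not_and, not_forall] at hφ
    by_cases h : (incidence φ).det = 0
    · rw [h, mul_zero]
    · obtain ⟨v, hv⟩ := hφ (isParentFun_of_det_incidence_ne_zero h)
      rw [Finset.prod_eq_zero (Finset.mem_univ v) (w.eq_zero _ _ hv), zero_mul]

end MatrixTree

/-! ### The determinant of a diagonal perturbation -/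

section Minors

open Polynomial
open scoped Matrix

variable {n : Type*} [Fintype n] [DecidableEq n]

/-- Expansion of `det (M + diagonal d)` in principal minors of `M`. -/
theorem det_add_diagonal {R : Type*} [CommRing R] (M : Matrix n n R) (d : n → R) :
    (M + Matrix.diagonal d).det = ∑ s : Finset n, (∏ i ∈ s, d i) *
      (M.submatrix (Subtype.val : {x // x ∉ s} → n) Subtype.val).det := by
  rw [add_comm]
  refine ((Matrix.detRowAlternating (R := R) (n := n)).toMultilinearMap.map_add_univ
    (Matrix.diagonal d) M).trans (Finset.sum_congr rfl fun s _ => ?_)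
  change Matrix.det (s.piecewise (Matrix.diagonal d) M : Matrix n n R) = _
  set P : Matrix n n R := s.piecewise (Matrix.diagonal d) M
  have hmem : ∀ i ∈ s, ∀ j, P i j = Matrix.diagonal d i j := fun i hi j =>
    congrFun (Finset.piecewise_eq_of_mem s (fun i => Matrix.diagonal d i) (fun i => M i) hi) j
  have hnotMem : ∀ i ∉ s, ∀ j, P i j = M i j := fun i hi j =>
    congrFun (Finset.piecewise_eq_of_notMem s (fun i => Matrix.diagonal d i) (fun i => M i) hi) j
  -- The rows indexed by `s` are diagonal, so they vanish in the columns outside `s`. Transposing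
  -- puts the zero block where the triangular formula expects it.
  rw [← Matrix.det_transpose, Matrix.twoBlockTriangular_det _ (· ∈ s)]
  · have h1 : Pᵀ.toSquareBlockProp (· ∈ s) = Matrix.diagonal fun i : {x // x ∈ s} => d i := by
      ext ⟨i, hi⟩ ⟨j, hj⟩
      rw [Matrix.toSquareBlockProp_def, Matrix.of_apply, Matrix.transpose_apply,
        hmem _ hj, Matrix.diagonal_apply, Matrix.diagonal_apply]
      simp only [Subtype.mk.injEq]
      by_cases h : i = j
      · subst h; simp
      · rw [if_neg h, if_neg fun h' => h h'.symm]
    have h2 : Pᵀ.toSquareBlockProp (fun i => ¬ i ∈ s) =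
        (M.submatrix (Subtype.val : {x // x ∉ s} → n) Subtype.val)ᵀ := by
      ext ⟨i, hi⟩ ⟨j, hj⟩
      rw [Matrix.toSquareBlockProp_def, Matrix.of_apply, Matrix.transpose_apply,
        hnotMem _ hj]
      rfl
    rw [h1, h2, Matrix.det_transpose]
    refine congrArg₂ _ ?_ rfl
    have hdiag : ∀ (q : n → Prop) [DecidablePred q],
        (Matrix.diagonal fun i : {x // q x} => d i).det = ∏ i : {x // q x}, d i :=
      fun q _ => Matrix.det_diagonal
    exact (hdiag (· ∈ s)).trans
      (Finset.prod_subtype s (fun _ => Iff.rfl) d).symm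
  · intro i hi j hj
    rw [Matrix.transpose_apply, hmem _ hj, Matrix.diagonal_apply_ne]
    rintro rfl
    exact hi hj

/-- The polynomial `det (M + X • diagonal a)`. -/
def minorPoly (M : Matrix n n ℂ) (a : n → ℂ) : ℂ[X] :=
  ∑ s : Finset n, C ((∏ i ∈ s, a i) *
    (M.submatrix (Subtype.val : {x // x ∉ s} → n) Subtype.val).det) * X ^ s.card

theorem eval_minorPoly (M : Matrix n n ℂ) (a : n → ℂ) (x : ℂ) :
    (minorPoly M a).eval x = (M + x • Matrix.diagonal a).det := by
  rw [← Matrix.diagonal_smul, det_add_diagonal, minorPoly, eval_finsetSum]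
  refine Finset.sum_congr rfl fun s _ => ?_
  simp only [eval_mul, eval_C, eval_pow, eval_X, Pi.smul_apply, smul_eq_mul,
    Finset.prod_mul_distrib, Finset.prod_const]
  ring

theorem coeff_minorPoly (M : Matrix n n ℂ) (a : n → ℂ) (k : ℕ) :
    (minorPoly M a).coeff k = ∑ s ∈ Finset.univ.powersetCard k, (∏ i ∈ s, a i) *
      (M.submatrix (Subtype.val : {x // x ∉ s} → n) Subtype.val).det := by
  rw [minorPoly, finsetSum_coeff, ← Finset.powerset_univ, Finset.powersetCard_eq_filter,
    Finset.sum_filter]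
  refine Finset.sum_congr rfl fun s _ => ?_
  rw [coeff_C_mul, coeff_X_pow]
  by_cases h : s.card = k
  · simp [h]
  · rw [if_neg h, if_neg fun h' => h h'.symm, mul_zero]

theorem det_submatrix_congr (M : Matrix n n ℂ) {P Q : n → Prop} [DecidablePred P]
    [DecidablePred Q] (h : ∀ x, P x ↔ Q x) :
    (M.submatrix (Subtype.val : {x // P x} → n) Subtype.val).det =
      (M.submatrix (Subtype.val : {x // Q x} → n) Subtype.val).det :=
  Matrix.det_submatrix_equiv_self (Equiv.subtypeEquivRight h)
    (M.submatrix (Subtype.val : {x // Q x} → n) Subtype.val)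

theorem coeff_zero_minorPoly (M : Matrix n n ℂ) (a : n → ℂ) :
    (minorPoly M a).coeff 0 = M.det := by
  rw [coeff_zero_eq_eval_zero, eval_minorPoly, zero_smul, add_zero]

theorem coeff_one_minorPoly (M : Matrix n n ℂ) (a : n → ℂ) :
    (minorPoly M a).coeff 1 = ∑ p, a p *
      (M.submatrix (Subtype.val : {x // x ≠ p} → n) Subtype.val).det := by
  rw [coeff_minorPoly, Finset.powersetCard_one, Finset.sum_map]
  refine Finset.sum_congr rfl fun p _ => ?_
  have hp : ∀ x, x ∉ ({p} : Finset n) ↔ x ≠ p := fun x => by simp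
  exact congrArg₂ _ (Finset.prod_singleton _ _) (det_submatrix_congr M hp)

/-- Each two-element set is the image of exactly two ordered pairs. -/
theorem two_mul_sum_powersetCard_two (g : Finset n → ℂ) :
    2 * ∑ s ∈ Finset.univ.powersetCard 2, g s = ∑ p, ∑ q, if p = q then 0 else g {p, q} := by
  have h1 : ∑ p, ∑ q, (if p = q then 0 else g {p, q}) =
      ∑ x ∈ (Finset.univ : Finset n).offDiag, g {x.1, x.2} := by
    have hod : (Finset.univ : Finset n).offDiag =
        ((Finset.univ : Finset n) ×ˢ Finset.univ).filter fun x => x.1 ≠ x.2 := by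
      ext; simp
    rw [hod, Finset.sum_filter, Finset.sum_product]
    simp only [ne_eq, ite_not]
  have hmaps : ∀ x ∈ (Finset.univ : Finset n).offDiag,
      ({x.1, x.2} : Finset n) ∈ Finset.univ.powersetCard 2 := by
    intro x hx
    rw [Finset.mem_offDiag] at hx
    exact Finset.mem_powersetCard.mpr ⟨Finset.subset_univ _, Finset.card_pair hx.2.2⟩
  rw [h1, ← Finset.sum_fiberwise_of_maps_to hmaps, Finset.mul_sum]
  refine Finset.sum_congr rfl fun s hs => ?_
  obtain ⟨x, y, hxy, rfl⟩ := Finset.card_eq_two.mp (Finset.mem_powersetCard.mp hs).2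
  have hfib : ((Finset.univ : Finset n).offDiag.filter fun z => ({z.1, z.2} : Finset n) = {x, y}) =
      {(x, y), (y, x)} := by
    ext ⟨z₁, z₂⟩
    simp only [Finset.mem_filter, Finset.mem_offDiag, Finset.mem_univ, true_and,
      Finset.mem_insert, Finset.mem_singleton, Prod.mk.injEq]
    constructor
    · rintro ⟨hz, he⟩
      have h1 : z₁ ∈ ({x, y} : Finset n) := he ▸ Finset.mem_insert_self _ _
      have h2 : z₂ ∈ ({x, y} : Finset n) := by rw [← he]; simp
      simp only [Finset.mem_insert, Finset.mem_singleton] at h1 h2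
      rcases h1 with rfl | rfl <;> rcases h2 with rfl | rfl <;> simp_all
    · rintro (⟨rfl, rfl⟩ | ⟨rfl, rfl⟩)
      · exact ⟨hxy, rfl⟩
      · exact ⟨hxy.symm, Finset.pair_comm _ _⟩
  rw [hfib, Finset.sum_pair (by simp [hxy]), Finset.pair_comm y x, two_mul]

theorem coeff_two_minorPoly (M : Matrix n n ℂ) (a : n → ℂ) :
    (minorPoly M a).coeff 2 = (∑ p, ∑ q, if p = q then 0 else a p * a q *
      (M.submatrix (Subtype.val : {x // x ≠ p ∧ x ≠ q} → n) Subtype.val).det) / 2 := by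
  rw [coeff_minorPoly, eq_div_iff two_ne_zero, mul_comm, two_mul_sum_powersetCard_two]
  refine Finset.sum_congr rfl fun p _ => Finset.sum_congr rfl fun q _ => ?_
  by_cases h : p = q
  · rw [if_pos h, if_pos h]
  · have hp : ∀ x, x ∉ ({p, q} : Finset n) ↔ x ≠ p ∧ x ≠ q := fun x => by simp
    rw [if_neg h, if_neg h, Finset.prod_pair h, det_submatrix_congr M hp]

theorem hasDerivAt_minorPoly (M : Matrix n n ℂ) (a : n → ℂ) :
    HasDerivAt (fun x : ℂ => (M + x • Matrix.diagonal a).det) ((minorPoly M a).coeff 1) 0 := by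
  have h := (minorPoly M a).hasDerivAt 0
  rw [← coeff_zero_eq_eval_zero, coeff_derivative] at h
  simp only [eval_minorPoly, zero_add, Nat.cast_zero, mul_one] at h
  exact h

end Minors

/-! ### Logarithmic derivatives of determinants -/

section LogDeriv

variable {n : Type*} [Fintype n] [DecidableEq n]

theorem hasDerivAt_det {B : ℂ → Matrix n n ℂ} {B' : Matrix n n ℂ} {x : ℂ}
    (h : ∀ i j, HasDerivAt (fun y => B y i j) (B' i j) x) :
    HasDerivAt (fun y => (B y).det) (∑ σ : Equiv.Perm n, ((Equiv.Perm.sign σ : ℤ) : ℂ) *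
      ∑ i, (∏ j ∈ Finset.univ.erase i, B x (σ j) j) • B' (σ i) i) x := by
  simp only [Matrix.det_apply']
  exact HasDerivAt.fun_sum fun σ _ =>
    (HasDerivAt.fun_finsetProd fun i _ => h (σ i) i).const_mul _

/-- The derivative of a determinant depends only on the first-order jet of the matrix. -/
theorem logDeriv_det_congr {B C : ℂ → Matrix n n ℂ} {B' : Matrix n n ℂ} {x : ℂ}
    (hB : ∀ i j, HasDerivAt (fun y => B y i j) (B' i j) x)
    (hC : ∀ i j, HasDerivAt (fun y => C y i j) (B' i j) x) (h : B x = C x) :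
    logDeriv (fun y => (B y).det) x = logDeriv (fun y => (C y).det) x := by
  rw [logDeriv_apply, logDeriv_apply, (hasDerivAt_det hB).deriv, (hasDerivAt_det hC).deriv, h]

/-- Only the first-order jet matters, so `B` may be replaced by `t (M - (y - x) diag a)`. The
constant power of `t` then drops out of the logarithmic derivative. -/
theorem logDeriv_det_of_jet_smul_diagonal {B : ℂ → Matrix n n ℂ} {M : Matrix n n ℂ} {a : n → ℂ}
    {x t : ℂ} (ht : t ≠ 0) (h0 : B x = t • M)
    (h : ∀ i j, HasDerivAt (fun y => B y i j) (-t * Matrix.diagonal a i j) x) :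
    logDeriv (fun y => (B y).det) x = -((minorPoly M a).coeff 1 / M.det) := by
  rw [logDeriv_det_congr (B := B) (C := fun y => t • (M + (-(y - x)) • Matrix.diagonal a))
    (B' := (-t) • Matrix.diagonal a) (by simpa using h)]
  · have h1 : HasDerivAt (fun y : ℂ => (M + (-(y - x)) • Matrix.diagonal a).det)
        ((minorPoly M a).coeff 1 * (-1)) x := by
      refine HasDerivAt.comp x (h₂ := fun z : ℂ => (M + z • Matrix.diagonal a).det) ?_
        ((hasDerivAt_id x).sub_const x).neg
      simpa using hasDerivAt_minorPoly M a
    simp only [Matrix.det_smul]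
    rw [logDeriv_const_mul _ _ (pow_ne_zero _ ht), logDeriv_apply, h1.deriv]
    simp [neg_div]
  · intro i j
    have h1 := (((hasDerivAt_id x).sub_const x).neg.mul_const
      (Matrix.diagonal a i j)).const_add (M i j) |>.const_mul t
    exact h1.congr_deriv (by simp)
  · simp [h0]

theorem logDeriv_det_of_jet_smul_add_diagonal {B : ℂ → Matrix n n ℂ} {M : Matrix n n ℂ}
    {a : n → ℂ} {t : ℂ} (ht : t ≠ 0) (hM : M.det ≠ 0) (h0 : B t = t • M)
    (h : ∀ i j, HasDerivAt (fun y => B y i j) (M i j + t⁻¹ * Matrix.diagonal a i j) t) :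
    logDeriv (fun y => (B y).det) t =
      Fintype.card n / t + (minorPoly M a).coeff 1 / M.det / t ^ 2 := by
  -- This curve has the same jet and equals `y (M + (t⁻¹ - y⁻¹) diag a)` for `y ≠ 0`. Its
  -- determinant splits into a power of `y` and a value of the minor polynomial.
  rw [logDeriv_det_congr (B := B) (C := fun y => y • M + ((y - t) / t) • Matrix.diagonal a)
    (B' := M + t⁻¹ • Matrix.diagonal a) (by simpa using h)]
  · have hev : (fun y : ℂ => (y • M + ((y - t) / t) • Matrix.diagonal a).det) =ᶠ[nhds t]
        fun y => y ^ Fintype.card n * (M + (t⁻¹ - y⁻¹) • Matrix.diagonal a).det := by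
      filter_upwards [isOpen_ne.mem_nhds ht] with y hy
      rw [← Matrix.det_smul, smul_add, smul_smul]
      congr 3
      have hy : y ≠ 0 := hy
      field_simp
    have h1 : HasDerivAt (fun y : ℂ => (M + (t⁻¹ - y⁻¹) • Matrix.diagonal a).det)
        ((minorPoly M a).coeff 1 * (-(-(t ^ 2)⁻¹))) t := by
      refine HasDerivAt.comp t (h₂ := fun z : ℂ => (M + z • Matrix.diagonal a).det) ?_
        ((hasDerivAt_inv ht).const_sub t⁻¹)
      simpa using hasDerivAt_minorPoly M a
    have h2 := (hasDerivAt_pow (Fintype.card n) t).mul h1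
    rw [logDeriv_apply, hev.deriv_eq, hev.eq_of_nhds]
    rw [show (fun y : ℂ => y ^ Fintype.card n * (M + (t⁻¹ - y⁻¹) • Matrix.diagonal a).det) =
      (fun y : ℂ => y ^ Fintype.card n) * fun y : ℂ =>
        (M + (t⁻¹ - y⁻¹) • Matrix.diagonal a).det from rfl, h2.deriv]
    simp only [sub_self, zero_smul, add_zero]
    -- The derivative of the power contains the truncated exponent `card n - 1`, so size `0` is
    -- separate.
    rcases Nat.eq_zero_or_pos (Fintype.card n) with hn | hn
    · simp only [hn]
      field_simp
      simp
    · obtain ⟨m, hm⟩ := Nat.exists_eq_succ_of_ne_zero hn.ne'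
      rw [hm, Nat.succ_sub_one, pow_succ]
      field_simp
  · intro i j
    have h1 := ((hasDerivAt_id t).mul_const (M i j)).add
      ((((hasDerivAt_id t).sub_const t).div_const t).mul_const (Matrix.diagonal a i j))
    exact h1.congr_deriv (by simp)
  · simp [h0]

end LogDeriv

/-! ### Matrix coefficients of the irreducible representations -/

section Irreps

open scoped MonoidAlgebra

variable {Γ : Type*} [Group Γ]

theorem toRep_apply {d : ℕ} (ρ : Γ →* Matrix (Fin d) (Fin d) ℂ) (g : Γ) (v : Fin d → ℂ) :
    toRep ρ g v = (ρ g).mulVec v := rfl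

/-- The intertwining map given by a matrix. -/
def intertwiningMapOfMatrix {d e : ℕ} (ρ : Γ →* Matrix (Fin d) (Fin d) ℂ)
    (σ : Γ →* Matrix (Fin e) (Fin e) ℂ) (X : Matrix (Fin e) (Fin d) ℂ)
    (h : ∀ g, X * ρ g = σ g * X) : (toRep ρ).IntertwiningMap (toRep σ) where
  toLinearMap := X.mulVecLin
  isIntertwining' g := by
    refine LinearMap.ext fun v => ?_
    change X.mulVec ((ρ g).mulVec v) = (σ g).mulVec (X.mulVec v)
    rw [Matrix.mulVec_mulVec, Matrix.mulVec_mulVec, h]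

theorem eq_zero_of_intertwines {d e : ℕ} {ρ : Γ →* Matrix (Fin d) (Fin d) ℂ}
    {σ : Γ →* Matrix (Fin e) (Fin e) ℂ} (hρ : (toRep ρ).IsIrreducible)
    (hσ : (toRep σ).IsIrreducible) (hne : ¬ Nonempty ((toRep ρ).Equiv (toRep σ)))
    {X : Matrix (Fin e) (Fin d) ℂ} (h : ∀ g, X * ρ g = σ g * X) : X = 0 := by
  rcases Representation.IsIrreducible.bijective_or_eq_zero (intertwiningMapOfMatrix ρ σ X h) with
    hb | h0
  · exact absurd ⟨(intertwiningMapOfMatrix ρ σ X h).ofBijective hb⟩ hne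
  · have h1 : X.mulVecLin = 0 := congrArg (fun F => F.toLinearMap) h0
    exact Matrix.toLin'.map_eq_zero_iff.mp h1

theorem exists_eq_smul_one_of_commutes {d : ℕ} {ρ : Γ →* Matrix (Fin d) (Fin d) ℂ}
    (hρ : (toRep ρ).IsIrreducible) {X : Matrix (Fin d) (Fin d) ℂ}
    (h : ∀ g, X * ρ g = ρ g * X) : ∃ c : ℂ, X = c • 1 := by
  obtain ⟨c, hc⟩ := (Representation.IsIrreducible.algebraMap_intertwiningMap_bijective_of_isAlgClosed
    (ρ := toRep ρ)).2 (intertwiningMapOfMatrix ρ ρ X h)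
  refine ⟨c, Matrix.toLin'.injective ?_⟩
  have h1 : X.mulVecLin = (algebraMap ℂ ((toRep ρ).IntertwiningMap (toRep ρ)) c).toLinearMap :=
    congrArg (fun F => F.toLinearMap) hc.symm
  refine h1.trans ?_
  rw [map_smul, Matrix.toLin'_one]
  rfl

theorem average_commutes [Fintype Γ] {d e : ℕ} (ρ : Γ →* Matrix (Fin d) (Fin d) ℂ)
    (σ : Γ →* Matrix (Fin e) (Fin e) ℂ) (X : Matrix (Fin e) (Fin d) ℂ) (g : Γ) :
    (∑ h, σ h * X * ρ h⁻¹) * ρ g = σ g * ∑ h, σ h * X * ρ h⁻¹ := by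
  rw [Matrix.sum_mul, Matrix.mul_sum, ← Equiv.sum_comp (Equiv.mulLeft g)]
  refine Finset.sum_congr rfl fun h _ => ?_
  simp only [Equiv.coe_mulLeft, mul_inv_rev, map_mul, Matrix.mul_assoc]
  rw [← map_mul ρ g⁻¹ g, inv_mul_cancel, map_one, Matrix.mul_one]

/-- Schur orthogonality: the average of a matrix unit over the group intertwines `ρ` and `σ`, so it
is zero. The sum is one entry of this average. -/
theorem sum_mul_eq_zero_of_not_equiv [Fintype Γ] {d e : ℕ} {ρ : Γ →* Matrix (Fin d) (Fin d) ℂ}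
    {σ : Γ →* Matrix (Fin e) (Fin e) ℂ} (hρ : (toRep ρ).IsIrreducible)
    (hσ : (toRep σ).IsIrreducible) (hne : ¬ Nonempty ((toRep ρ).Equiv (toRep σ)))
    (a b : Fin d) (c c' : Fin e) : ∑ h, ρ h⁻¹ b a * σ h c c' = 0 := by
  have h0 := eq_zero_of_intertwines hρ hσ hne
    (average_commutes ρ σ (Matrix.single c' b 1))
  have h1 := congrFun (congrFun h0 c) a
  rw [Matrix.sum_apply] at h1
  rw [Matrix.zero_apply] at h1
  rw [← h1]
  refine Finset.sum_congr rfl fun h _ => ?_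
  rw [Matrix.mul_assoc, Matrix.mul_apply, Finset.sum_eq_single c']
  · rw [Matrix.single_mul_apply_same, one_mul, mul_comm]
  · intro x _ hx
    rw [Matrix.single_mul_apply_of_ne _ _ _ _ _ hx, mul_zero]
  · simp

/-- The averaged matrix unit is now a scalar `z`. Comparing traces gives `d z = |Γ|` if `b = c'` and
`d z = 0` otherwise. -/
theorem mul_sum_mul_eq [Fintype Γ] {d : ℕ} {ρ : Γ →* Matrix (Fin d) (Fin d) ℂ}
    (hρ : (toRep ρ).IsIrreducible) (a b c c' : Fin d) :
    (d : ℂ) * ∑ h, ρ h⁻¹ b a * ρ h c c' =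
      if a = c ∧ b = c' then (Fintype.card Γ : ℂ) else 0 := by
  obtain ⟨z, hz⟩ := exists_eq_smul_one_of_commutes hρ
    (average_commutes ρ ρ (Matrix.single c' b 1))
  have htr := congrArg Matrix.trace hz
  have h2 : ∀ h, (ρ h * Matrix.single c' b (1 : ℂ) * ρ h⁻¹).trace = if b = c' then 1 else 0 := by
    intro h
    rw [Matrix.trace_mul_comm, ← Matrix.mul_assoc, ← map_mul, inv_mul_cancel, map_one,
      Matrix.one_mul]
    by_cases hb : b = c'
    · rw [if_pos hb, hb, Matrix.trace_single_eq_same]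
    · rw [if_neg hb, Matrix.trace_single_eq_of_ne _ _ _ fun h => hb h.symm]
  rw [Matrix.trace_sum, Finset.sum_congr rfl fun h _ => h2 h, Matrix.trace_smul,
    Matrix.trace_one] at htr
  have h1 := congrFun (congrFun hz c) a
  rw [Matrix.sum_apply] at h1
  have h3 : ∑ h, ρ h⁻¹ b a * ρ h c c' = z * if a = c then 1 else 0 := by
    have h4 : (z • (1 : Matrix (Fin d) (Fin d) ℂ)) c a = z * if a = c then 1 else 0 := by
      rw [Matrix.smul_apply, Matrix.one_apply, smul_eq_mul]
      simp only [eq_comm]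
    rw [← h4, ← h1]
    refine Finset.sum_congr rfl fun h _ => ?_
    rw [Matrix.mul_assoc, Matrix.mul_apply, Finset.sum_eq_single c']
    · rw [Matrix.single_mul_apply_same, one_mul, mul_comm]
    · intro x _ hx
      rw [Matrix.single_mul_apply_of_ne _ _ _ _ _ hx, mul_zero]
    · simp
  rw [h3]
  simp only [Finset.sum_const, Finset.card_univ, nsmul_eq_mul, Fintype.card_fin,
    smul_eq_mul] at htr
  by_cases ha : a = c <;> by_cases hb : b = c' <;> simp_all [mul_comm]

/-- A simple left ideal of the group algebra is given by an irreducible matrix representation. -/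
theorem exists_matrix_rep_of_isSimpleModule [Fintype Γ] (m : Submodule ℂ[Γ] ℂ[Γ])
    [IsSimpleModule ℂ[Γ] m] : ∃ (d : ℕ) (σ : Γ →* Matrix (Fin d) (Fin d) ℂ)
      (e : m ≃ₗ[ℂ] (Fin d → ℂ)), (toRep σ).IsIrreducible ∧
        ∀ g y, e (MonoidAlgebra.single g (1 : ℂ) • y) = toRep σ g (e y) := by
  have : FiniteDimensional ℂ ℂ[Γ] := inferInstance
  have : FiniteDimensional ℂ m :=
    FiniteDimensional.finiteDimensional_submodule (m.restrictScalars ℂ)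
  let b := Module.finBasis ℂ m
  let σ : Γ →* Matrix (Fin (Module.finrank ℂ m)) (Fin (Module.finrank ℂ m)) ℂ :=
    (LinearMap.toMatrixAlgEquiv b).toAlgHom.toMonoidHom.comp
      (Representation.ofModule' (k := ℂ) (G := Γ) m)
  have hσ : ∀ g y, b.equivFun (MonoidAlgebra.single g (1 : ℂ) • y) = toRep σ g (b.equivFun y) := by
    intro g y
    rw [toRep_apply]
    exact (LinearMap.toMatrix_mulVec_repr b b
      (Representation.ofModule' (k := ℂ) (G := Γ) m g) y).symm
  refine ⟨_, σ, b.equivFun, ?_, hσ⟩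
  rw [Representation.irreducible_iff_isSimpleModule_asModule]
  let e : m ≃ₗ[ℂ[Γ]] (toRep σ).asModule :=
    { toFun := fun y => (toRep σ).asModuleEquiv.symm (b.equivFun y)
      invFun := fun v => b.equivFun.symm ((toRep σ).asModuleEquiv v)
      left_inv := fun y => by simp
      right_inv := fun v => by
        beta_reduce
        rw [LinearEquiv.apply_symm_apply, LinearEquiv.symm_apply_apply]
      map_add' := fun y z => by simp
      map_smul' := fun r y => by
        induction r using MonoidAlgebra.induction_linear with
        | zero => simp
        | add r s hr hs =>
          simp only [add_smul, map_add, RingHom.id_apply] at hr hs ⊢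
          rw [hr, hs]
        | single g a =>
          have h1 : MonoidAlgebra.single g a • y = a • (MonoidAlgebra.single g (1 : ℂ) • y) := by
            rw [← smul_assoc, MonoidAlgebra.smul_single, smul_eq_mul, mul_one]
          rw [h1, map_smul, hσ]
          simp [Representation.single_smul]
          rfl }
  exact IsSimpleModule.congr e.symm

variable {ι : Type*} {f : ι → ℕ} {ρ : (i : ι) → Γ →* Matrix (Fin (f i)) (Fin (f i)) ℂ}

/-- The element `∑ x_h h` of the group algebra annihilates every simple left ideal, each being some
`ρ i`. By semisimplicity these ideals span the algebra, so the element annihilates `1`. -/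
theorem IsAllIrreps.eq_zero_of_sum_smul_eq_zero [Fintype Γ] (hρ : IsAllIrreps ρ) {x : Γ → ℂ}
    (hx : ∀ i, ∑ h, x h • ρ i h = 0) : x = 0 := by
  let X : ℂ[Γ] := ∑ h, MonoidAlgebra.single h (x h)
  have hsimple : ∀ m : Submodule ℂ[Γ] ℂ[Γ], IsSimpleModule ℂ[Γ] m → ∀ y ∈ m, X * y = 0 := by
    intro m hm y hy
    obtain ⟨d, σ, e, hσ, he⟩ := exists_matrix_rep_of_isSimpleModule m
    obtain ⟨i, ⟨φ⟩⟩ := hρ.complete d σ hσ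
    have hv : ∀ v, ∑ h, x h • toRep σ h v = 0 := by
      intro v
      have h1 : φ (∑ h, x h • toRep σ h v) = 0 := by
        have h2 : φ (∑ h, x h • toRep σ h v) = ∑ h, x h • φ (toRep σ h v) := by
          simp only [map_sum, map_smul]
        rw [h2]
        have h3 : ∀ h, φ (toRep σ h v) = (ρ i h).mulVec (φ v) := fun h =>
          Representation.IntertwiningMap.isIntertwining _ _ φ.toIntertwiningMap h v
        simp only [h3, ← Matrix.smul_mulVec, ← Matrix.sum_mulVec, hx, Matrix.zero_mulVec]
      have h4 := φ.symm_apply_apply (∑ h, x h • toRep σ h v)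
      rw [h1, map_zero] at h4
      exact h4.symm
    have hXy : X • (⟨y, hy⟩ : m) = 0 := by
      apply e.injective
      rw [map_zero, ← hv (e ⟨y, hy⟩), Finset.sum_smul, map_sum]
      refine Finset.sum_congr rfl fun h _ => ?_
      rw [← he, ← map_smul, ← smul_assoc, MonoidAlgebra.smul_single, smul_eq_mul, mul_one]
    exact congrArg Subtype.val hXy
  have hall : ∀ y : ℂ[Γ], X * y = 0 := by
    intro y
    have hy : y ∈ sSup {m : Submodule ℂ[Γ] ℂ[Γ] | IsSimpleModule ℂ[Γ] m} := by
      rw [IsSemisimpleModule.sSup_simples_eq_top]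
      trivial
    rw [sSup_eq_iSup'] at hy
    induction hy using Submodule.iSup_induction' with
    | mem m y hy => exact hsimple m.1 m.2 y hy
    | zero => exact mul_zero X
    | add y z _ _ hy hz => rw [mul_add, hy, hz, add_zero]
  have hX : X = 0 := by rw [← mul_one X, hall]
  funext g
  have h1 : X.coeff g = x g := by
    classical
    simp [X, Finsupp.single_apply]
  rw [← h1, hX]
  rfl

end Irreps

/-! ### Group determinants -/

section GroupDeterminant

theorem det_blockDiagonal' {o R : Type*} [Fintype o] [DecidableEq o] [CommRing R] {m : o → Type*}
    [∀ i, Fintype (m i)] [∀ i, DecidableEq (m i)] (M : ∀ i, Matrix (m i) (m i) R) :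
    (Matrix.blockDiagonal' M).det = ∏ i, (M i).det := by
  -- An arbitrary order on the block indices, needed only to view the matrix as block triangular.
  let _ : LinearOrder o := LinearOrder.lift' (Fintype.equivFin o) (Fintype.equivFin o).injective
  rw [(Matrix.blockTriangular_blockDiagonal' M).det_fintype]
  refine Finset.prod_congr rfl fun i _ => ?_
  let e : m i ≃ {x : Σ i, m i // x.1 = i} :=
    { toFun := fun y => ⟨⟨i, y⟩, rfl⟩
      invFun := fun x => x.2 ▸ x.1.2
      left_inv := fun _ => rfl
      right_inv := by rintro ⟨⟨_, y⟩, rfl⟩; rfl }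
  rw [← Matrix.det_submatrix_equiv_self e]
  congr 1
  ext x y
  exact Matrix.blockDiagonal'_apply_eq M i x y

variable {Γ : Type*} [Group Γ] {ι : Type*} {f : ι → ℕ}
  (ρ : (i : ι) → Γ →* Matrix (Fin (f i)) (Fin (f i)) ℂ)

/-- The index set of the matrix coefficients of the representations `ρ`. -/
abbrev CoefIndex (f : ι → ℕ) : Type _ := Σ x : (Σ i, Fin (f i)), Fin (f x.1)

/-- The matrix coefficients, as functions on the group. -/
def coefMatrix : Matrix Γ (CoefIndex f) ℂ :=
  fun h x => ρ x.1.1 h x.1.2 x.2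

/-- The normalized matrix coefficients of the dual representations. -/
def dualCoefMatrix [Fintype Γ] : Matrix (CoefIndex f) Γ ℂ :=
  fun x h => (f x.1.1 : ℂ) / Fintype.card Γ * ρ x.1.1 h⁻¹ x.2 x.1.2

/-- The permutation matrices of the right regular representation. -/
def translation [DecidableEq Γ] (g : Γ) : Matrix Γ Γ ℂ :=
  fun h h' => if h' = h * g then 1 else 0

/-- This is `ρ(hg) = ρ(h) ρ(g)` read entrywise. For fixed `i`, each row index of `ρ i` spans its own
translation-stable block, which is why `ρ i` occurs `f i` times. -/
theorem translation_mul_coefMatrix [Fintype Γ] [DecidableEq Γ] [Fintype ι] [DecidableEq ι] (g : Γ) :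
    translation g * coefMatrix ρ =
      coefMatrix ρ * Matrix.blockDiagonal' fun x : (Σ i, Fin (f i)) => ρ x.1 g := by
  ext h ⟨⟨i, a⟩, b⟩
  rw [Matrix.mul_apply, Matrix.mul_apply, Fintype.sum_sigma, Finset.sum_eq_single (h * g),
    Finset.sum_eq_single (⟨i, a⟩ : Σ i, Fin (f i))]
  · simp only [translation, coefMatrix, if_true, one_mul, map_mul, Matrix.mul_apply,
      Matrix.blockDiagonal'_apply_eq]
  · intro x _ hx
    refine Finset.sum_eq_zero fun y _ => ?_
    rw [Matrix.blockDiagonal'_apply_ne _ _ _ hx, mul_zero]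
  · simp
  · intro x _ hx
    rw [translation, if_neg hx, zero_mul]
  · simp

variable {ρ}

theorem IsAllIrreps.dualCoefMatrix_mul_coefMatrix [Fintype Γ] [DecidableEq ι]
    (hρ : IsAllIrreps ρ) : dualCoefMatrix ρ * coefMatrix ρ = 1 := by
  have hcard : (Fintype.card Γ : ℂ) ≠ 0 := Nat.cast_ne_zero.mpr Fintype.card_ne_zero
  ext ⟨⟨i, a⟩, b⟩ ⟨⟨j, c⟩, c'⟩
  have h1 : (dualCoefMatrix ρ * coefMatrix ρ) ⟨⟨i, a⟩, b⟩ ⟨⟨j, c⟩, c'⟩ =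
      (f i : ℂ) / Fintype.card Γ * ∑ h, ρ i h⁻¹ b a * ρ j h c c' := by
    simp only [Matrix.mul_apply, dualCoefMatrix, coefMatrix, Finset.mul_sum, mul_assoc]
  rw [h1]
  by_cases hij : i = j
  · subst hij
    rw [div_mul_eq_mul_div, mul_sum_mul_eq (hρ.irreducible i), Matrix.one_apply]
    by_cases hac : a = c
    · subst hac
      by_cases hb : b = c'
      · subst hb
        simp [hcard]
      · rw [if_neg fun h => hb h.2, if_neg, zero_div]
        intro h
        exact hb (eq_of_heq (Sigma.mk.inj h).2)
    · rw [if_neg fun h => hac h.1, if_neg, zero_div]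
      intro h
      exact hac (eq_of_heq (Sigma.mk.inj (Sigma.mk.inj h).1).2)
  · rw [sum_mul_eq_zero_of_not_equiv (hρ.irreducible i) (hρ.irreducible j)
      (fun h => hij (hρ.inequivalent i j h)), mul_zero, Matrix.one_apply_ne]
    intro h
    exact hij (Sigma.mk.inj (Sigma.mk.inj h).1).1

/-- The index types differ, so the left inverse alone is not enough. Each row of `coefMatrix ρ *
dualCoefMatrix ρ - 1` is a function on `Γ` killed by every `ρ i`, hence zero by completeness. -/
theorem IsAllIrreps.coefMatrix_mul_dualCoefMatrix [Fintype Γ] [DecidableEq Γ] [Fintype ι]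
    [DecidableEq ι] (hρ : IsAllIrreps ρ) : coefMatrix ρ * dualCoefMatrix ρ = 1 := by
  have h0 : (coefMatrix ρ * dualCoefMatrix ρ - 1) * coefMatrix ρ = 0 := by
    rw [Matrix.sub_mul, Matrix.mul_assoc, hρ.dualCoefMatrix_mul_coefMatrix, Matrix.mul_one,
      Matrix.one_mul, sub_self]
  refine sub_eq_zero.mp (Matrix.ext fun g => congrFun ?_)
  refine hρ.eq_zero_of_sum_smul_eq_zero fun i => ?_
  ext a b
  have h1 := congrFun (congrFun h0 g) ⟨⟨i, a⟩, b⟩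
  rw [Matrix.mul_apply] at h1
  rw [Matrix.sum_apply]
  exact h1

/-- The two products of the mutually inverse coefficient matrices have equal traces, namely the
sizes of the two index sets. -/
theorem IsAllIrreps.sum_sq_eq_card [Fintype Γ] [Fintype ι] (hρ : IsAllIrreps ρ) :
    ∑ i, (f i : ℂ) * f i = Fintype.card Γ := by
  classical
  have h := Matrix.trace_mul_comm (coefMatrix ρ) (dualCoefMatrix ρ)
  rw [hρ.coefMatrix_mul_dualCoefMatrix, hρ.dualCoefMatrix_mul_coefMatrix, Matrix.trace_one,
    Matrix.trace_one] at h
  rw [h, Fintype.card_sigma, Fintype.sum_sigma]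
  simp

theorem IsAllIrreps.degree_ne_zero (hρ : IsAllIrreps ρ) (i : ι) : f i ≠ 0 := by
  intro h0
  have : IsEmpty (Fin (f i)) := by rw [h0]; infer_instance
  obtain ⟨x, y, hxy⟩ := (hρ.irreducible i).toNontrivial
  exact hxy (Subrepresentation.toSubmodule_injective (Subsingleton.elim _ _))

/-- In degree at least two, the coefficients at `(0,0)` and `(1,1)` would both be constantly `1`,
contradicting their orthogonality. -/
theorem IsAllIrreps.eq_one_of_trivial [Fintype Γ] (hρ : IsAllIrreps ρ) {i : ι}
    (hi : ∀ g, ρ i g = 1) : f i = 1 := by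
  have hcard : (Fintype.card Γ : ℂ) ≠ 0 := Nat.cast_ne_zero.mpr Fintype.card_ne_zero
  have hle : f i ≤ 1 := by
    by_contra hlt
    have h := mul_sum_mul_eq (hρ.irreducible i) ⟨0, by omega⟩ ⟨0, by omega⟩ ⟨1, by omega⟩
      ⟨1, by omega⟩
    simp only [hi, Matrix.one_apply_eq, Finset.sum_const, Finset.card_univ, nsmul_eq_mul,
      mul_one, Fin.mk.injEq, zero_ne_one, false_and, if_false, mul_eq_zero, hcard, or_false,
      Nat.cast_eq_zero] at h
    omega
  have hpos := hρ.degree_ne_zero i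
  omega

/-- Factorization of the group determinant with matrix entries. -/
theorem IsAllIrreps.det_sum_translation_kronecker [Fintype Γ] [DecidableEq Γ] [Fintype ι]
    (hρ : IsAllIrreps ρ) {V : Type*} [Fintype V] [DecidableEq V] (N : Γ → Matrix V V ℂ) :
    (∑ g, translation g ⊗ₖ N g).det = ∏ i, (∑ g, ρ i g ⊗ₖ N g).det ^ f i := by
  classical
  have hPQ : (dualCoefMatrix ρ ⊗ₖ (1 : Matrix V V ℂ)) * (coefMatrix ρ ⊗ₖ (1 : Matrix V V ℂ)) = 1 := by
    rw [← Matrix.mul_kronecker_mul, hρ.dualCoefMatrix_mul_coefMatrix, Matrix.mul_one,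
      Matrix.one_kronecker_one]
  have hQP : (coefMatrix ρ ⊗ₖ (1 : Matrix V V ℂ)) * (dualCoefMatrix ρ ⊗ₖ (1 : Matrix V V ℂ)) = 1 := by
    rw [← Matrix.mul_kronecker_mul, hρ.coefMatrix_mul_dualCoefMatrix, Matrix.mul_one,
      Matrix.one_kronecker_one]
  rw [← Matrix.det_conj_of_mul_eq_one hPQ hQP]
  have h1 : (dualCoefMatrix ρ ⊗ₖ (1 : Matrix V V ℂ)) * (∑ g, translation g ⊗ₖ N g) *
      (coefMatrix ρ ⊗ₖ (1 : Matrix V V ℂ)) =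
      ∑ g, (Matrix.blockDiagonal' fun x : (Σ i, Fin (f i)) => ρ x.1 g) ⊗ₖ N g := by
    rw [Matrix.mul_sum, Matrix.sum_mul]
    refine Finset.sum_congr rfl fun g _ => ?_
    rw [← Matrix.mul_kronecker_mul, ← Matrix.mul_kronecker_mul, Matrix.mul_assoc,
      translation_mul_coefMatrix, ← Matrix.mul_assoc, hρ.dualCoefMatrix_mul_coefMatrix,
      Matrix.one_mul, Matrix.one_mul, Matrix.mul_one]
  have h2 : (∑ g, (Matrix.blockDiagonal' fun x : (Σ i, Fin (f i)) => ρ x.1 g) ⊗ₖ N g) =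
      (Matrix.blockDiagonal' fun x : (Σ i, Fin (f i)) => ∑ g, ρ x.1 g ⊗ₖ N g).submatrix
        (Equiv.sigmaProdDistrib _ V) (Equiv.sigmaProdDistrib _ V) := by
    ext ⟨⟨x, b⟩, u⟩ ⟨⟨y, c⟩, v⟩
    rw [Matrix.sum_apply, Matrix.submatrix_apply]
    change ∑ g, Matrix.blockDiagonal' (fun x : (Σ i, Fin (f i)) => ρ x.1 g) ⟨x, b⟩ ⟨y, c⟩ *
      N g u v = Matrix.blockDiagonal' (fun x : (Σ i, Fin (f i)) => ∑ g, ρ x.1 g ⊗ₖ N g)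
        ⟨x, (b, u)⟩ ⟨y, (c, v)⟩
    by_cases hxy : x = y
    · subst hxy
      simp only [Matrix.blockDiagonal'_apply_eq]
      rw [Matrix.sum_apply]
      rfl
    · rw [Matrix.blockDiagonal'_apply_ne _ _ _ hxy]
      refine Finset.sum_eq_zero fun g _ => ?_
      rw [Matrix.blockDiagonal'_apply_ne _ _ _ hxy, zero_mul]
  rw [h1, h2, Matrix.det_submatrix_equiv_self, det_blockDiagonal', Fintype.prod_sigma]
  refine Finset.prod_congr rfl fun i _ => ?_
  exact (Finset.prod_const (∑ g, ρ i g ⊗ₖ N g).det).trans (by rw [Finset.card_univ, Fintype.card_fin])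

end GroupDeterminant

/-! ### The Kirchhoff index and the Laplacian -/

section Kirchhoff

variable {V : Type*} [Fintype V] [DecidableEq V] {G : SimpleGraph V} (w : SymmWeight G)

/-- Constant vectors lie in the kernel. -/
theorem SymmWeight.det_laplacian [Nonempty V] : w.laplacian.det = 0 := by
  refine Matrix.exists_mulVec_eq_zero_iff.mp ⟨fun _ => 1, ?_, ?_⟩
  · obtain ⟨v⟩ := ‹Nonempty V›
    exact fun h => one_ne_zero (congrFun h v)
  · funext v
    simp [SymmWeight.laplacian, SymmWeight.degMatrix, Matrix.mulVec, dotProduct, SymmWeight.degree, Matrix.diagonal_apply]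

theorem SymmWeight.coeff_one_minorPoly_laplacian (a : V → ℂ) :
    (minorPoly w.laplacian a).coeff 1 = (∑ v, a v) * w.complexity := by
  rw [coeff_one_minorPoly, Finset.sum_mul]
  exact Finset.sum_congr rfl fun p _ => by rw [w.det_laplacian_eq_complexity p]

theorem SymmWeight.coeff_two_minorPoly_laplacian (hκ : w.complexity ≠ 0) (t : ℂ) :
    (minorPoly w.laplacian fun v => w.degree v * t - 2).coeff 2 =
      w.complexity * w.kirchhoff t := by
  rw [coeff_two_minorPoly, SymmWeight.kirchhoff, mul_div_assoc', Finset.mul_sum]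
  congr 1
  refine Finset.sum_congr rfl fun p _ => ?_
  rw [Finset.mul_sum]
  refine Finset.sum_congr rfl fun q _ => ?_
  rw [SymmWeight.resistance]
  split_ifs
  · simp
  · field_simp

theorem SymmWeight.sum_degree : ∑ v, w.degree v = 2 * w.total := by
  classical
  have hmaps : ∀ x ∈ (Finset.univ.filter fun x : V × V => G.Adj x.1 x.2),
      s(x.1, x.2) ∈ G.edgeFinset := by
    intro x hx
    simpa using hx
  have h1 : ∑ v, w.degree v = ∑ x : V × V with G.Adj x.1 x.2, w.edge s(x.1, x.2) := by
    rw [Finset.sum_filter, Fintype.sum_prod_type]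
    refine Finset.sum_congr rfl fun u _ => Finset.sum_congr rfl fun v _ => ?_
    by_cases h : G.Adj u v
    · rw [if_pos h]; rfl
    · rw [if_neg h, w.eq_zero _ _ h]
  rw [h1, ← Finset.sum_fiberwise_of_maps_to hmaps, SymmWeight.total, Finset.mul_sum]
  refine Finset.sum_congr rfl fun e he => ?_
  induction e using Sym2.ind with
  | _ u v =>
    have huv : G.Adj u v := by simpa using he
    have hfib : ((Finset.univ.filter fun x : V × V => G.Adj x.1 x.2).filter
        fun x => s(x.1, x.2) = s(u, v)) = {(u, v), (v, u)} := by
      ext ⟨x, y⟩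
      simp only [Finset.mem_filter, Finset.mem_univ, true_and, Finset.mem_insert,
        Finset.mem_singleton, Prod.mk.injEq, Sym2.eq_iff]
      constructor
      · exact fun h => h.2
      · rintro (⟨rfl, rfl⟩ | ⟨rfl, rfl⟩)
        · exact ⟨huv, Or.inl ⟨rfl, rfl⟩⟩
        · exact ⟨huv.symm, Or.inr ⟨rfl, rfl⟩⟩
    rw [hfib, Finset.sum_pair (by simp [huv.ne]), Sym2.eq_swap, two_mul]

theorem SymmWeight.sum_degree_mul_sub (t : ℂ) :
    ∑ v, (w.degree v * t - 2) = 2 * (w.total * t - Fintype.card V) := by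
  rw [Finset.sum_sub_distrib, ← Finset.sum_mul, w.sum_degree]
  simp
  ring

end Kirchhoff

/-! ### The covering -/

section Cover

variable {V Γ : Type*} [Group Γ] [Fintype Γ] {G : SimpleGraph V} (α : Voltage G Γ)
  (w : SymmWeight G)

theorem Voltage.sum_part : ∑ g, α.part w g = w.W := by
  classical
  ext u v
  rw [Matrix.sum_apply]
  by_cases h : G.Adj u v
  · simp [Voltage.part, h]
  · simp [Voltage.part, h, w.eq_zero u v h]

variable [Fintype V]

theorem Voltage.degree_derivedWeight (x : V × Γ) :
    (α.derivedWeight w).degree x = w.degree x.1 := by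
  rw [SymmWeight.degree, SymmWeight.degree, Fintype.sum_prod_type]
  refine Finset.sum_congr rfl fun v _ => ?_
  by_cases h : G.Adj x.1 v
  · rw [Finset.sum_eq_single (x.2 * α.val x.1 v)]
    · exact if_pos ⟨h, rfl⟩
    · exact fun y _ hy => if_neg fun h' => hy h'.2
    · simp
  · simp [Voltage.derivedWeight, h, w.eq_zero x.1 v h]

variable [DecidableEq V]

/-- The Laplacian twisted by a matrix representation. -/
def Voltage.repLaplacian {d : ℕ} (ρ : Γ →* Matrix (Fin d) (Fin d) ℂ) :
    Matrix (Fin d × V) (Fin d × V) ℂ :=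
  (1 : Matrix (Fin d) (Fin d) ℂ) ⊗ₖ w.degMatrix - ∑ g, ρ g ⊗ₖ α.part w g

theorem Voltage.det_repLaplacian_add_of_trivial {d : ℕ} (hd : d = 1) (ρ : Γ →* Matrix (Fin d) (Fin d) ℂ)
    (hρ : ∀ g, ρ g = 1) (a : V → ℂ) (x : ℂ) :
    (α.repLaplacian w ρ + x • Matrix.diagonal fun y : Fin d × V => a y.2).det =
      (w.laplacian + x • Matrix.diagonal a).det := by
  subst hd
  rw [← Matrix.det_submatrix_equiv_self (Equiv.uniqueProd V (Fin 1)).symm]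
  congr 1
  ext u v
  have h1 : (∑ g, ρ g ⊗ₖ α.part w g) (0, u) (0, v) = w.W u v := by
    rw [← α.sum_part w, Matrix.sum_apply, Matrix.sum_apply]
    simp [hρ, Matrix.kroneckerMap_apply]
  have h2 : (α.repLaplacian w ρ) (0, u) (0, v) = w.laplacian u v := by
    rw [Voltage.repLaplacian, Matrix.sub_apply, h1]
    simp [SymmWeight.laplacian, Matrix.kroneckerMap_apply]
  rw [Matrix.submatrix_apply]
  change α.repLaplacian w ρ (0, u) (0, v) +
    x * Matrix.diagonal (fun y : Fin 1 × V => a y.2) (0, u) (0, v) =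
      w.laplacian u v + x * Matrix.diagonal a u v
  rw [h2]
  simp [Matrix.diagonal_apply]

variable [DecidableEq Γ]

/-- The coefficients in the group algebra of the Laplacian of the covering, perturbed by `x • a`. -/
def Voltage.perturbedPart (a : V → ℂ) (x : ℂ) (g : Γ) : Matrix V V ℂ :=
  (if g = 1 then w.degMatrix + x • Matrix.diagonal a else 0) - α.part w g

theorem Voltage.sum_kronecker_perturbedPart {m : Type*} [DecidableEq m] (τ : Γ → Matrix m m ℂ)
    (hτ : τ 1 = 1) (a : V → ℂ) (x : ℂ) :
    ∑ g, τ g ⊗ₖ α.perturbedPart w a x g =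
      ((1 : Matrix m m ℂ) ⊗ₖ w.degMatrix - ∑ g, τ g ⊗ₖ α.part w g) +
        x • Matrix.diagonal fun y : m × V => a y.2 := by
  have h1 : ∑ g, τ g ⊗ₖ (if g = 1 then w.degMatrix + x • Matrix.diagonal a else 0) =
      (1 : Matrix m m ℂ) ⊗ₖ (w.degMatrix + x • Matrix.diagonal a) := by
    rw [Finset.sum_eq_single 1]
    · rw [if_pos rfl, hτ]
    · intro g _ hg
      rw [if_neg hg, Matrix.kronecker_zero]
    · simp
  have h2 : ((1 : Matrix m m ℂ) ⊗ₖ Matrix.diagonal a) =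
      Matrix.diagonal fun y : m × V => a y.2 := by
    rw [← Matrix.diagonal_one, Matrix.diagonal_kronecker_diagonal]
    simp
  have h3 : ∀ g, τ g ⊗ₖ α.perturbedPart w a x g =
      τ g ⊗ₖ (if g = 1 then w.degMatrix + x • Matrix.diagonal a else 0) - τ g ⊗ₖ α.part w g := by
    intro g
    ext y z
    simp [Voltage.perturbedPart, Matrix.kroneckerMap_apply, mul_sub]
  rw [Finset.sum_congr rfl fun g _ => h3 g, Finset.sum_sub_distrib, h1, Matrix.kronecker_add,
    Matrix.kronecker_smul, h2]
  abel

/-- The entry from `(u, g)` to `(v, h)` depends on `g` and `h` only through `g⁻¹ * h`, because the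
perturbation is constant on fibres. -/
theorem Voltage.laplacian_derivedWeight_add (a : V → ℂ) (x : ℂ) :
    (α.derivedWeight w).laplacian + x • Matrix.diagonal (fun y : V × Γ => a y.1) =
      (∑ g, translation g ⊗ₖ α.perturbedPart w a x g).submatrix
        (Equiv.prodComm V Γ) (Equiv.prodComm V Γ) := by
  classical
  ext ⟨u, g⟩ ⟨v, h⟩
  rw [Matrix.submatrix_apply, Matrix.sum_apply]
  have hsum : ∑ c, (translation c ⊗ₖ α.perturbedPart w a x c) (g, u) (h, v) =
      α.perturbedPart w a x (g⁻¹ * h) u v := by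
    rw [Finset.sum_eq_single (g⁻¹ * h)]
    · simp [translation, Matrix.kroneckerMap_apply]
    · intro c _ hc
      rw [Matrix.kroneckerMap_apply, translation, if_neg, zero_mul]
      rintro rfl
      exact hc (by group)
    · simp
  refine Eq.trans ?_ hsum.symm
  have hW : (α.derivedWeight w).W (u, g) (v, h) = α.part w (g⁻¹ * h) u v := by
    have hiff : (G.Adj u v ∧ h = g * α.val u v) ↔ α.val u v = g⁻¹ * h ∧ G.Adj u v := by
      rw [and_comm, eq_inv_mul_iff_mul_eq, eq_comm]
    by_cases hc : G.Adj u v ∧ h = g * α.val u v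
    · exact (if_pos hc).trans (if_pos (hiff.mp hc)).symm
    · exact (if_neg hc).trans (if_neg fun h' => hc (hiff.mpr h')).symm
  simp only [SymmWeight.laplacian, SymmWeight.degMatrix, Matrix.add_apply, Matrix.sub_apply,
    Matrix.smul_apply, hW, Voltage.perturbedPart, Matrix.diagonal_apply, Prod.mk.injEq,
    Voltage.degree_derivedWeight]
  by_cases hgh : g = h
  · subst hgh
    by_cases huv : u = v
    · subst huv
      simp
      ring
    · simp [huv]
  · have hne : g⁻¹ * h ≠ 1 := fun h' => hgh (inv_mul_eq_one.mp h')
    simp [hgh, hne]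

open Polynomial in
-- At each `x` this is the group determinant factorization. The trivial representation contributes
-- the polynomial of `G` itself, to the first power.
theorem IsAllIrreps.minorPoly_laplacian_derivedWeight {k : ℕ} {f : Fin (k + 1) → ℕ}
    {ρ : (i : Fin (k + 1)) → Γ →* Matrix (Fin (f i)) (Fin (f i)) ℂ} (hρ : IsAllIrreps ρ)
    (hρ0 : ∀ g, ρ 0 g = 1) (a : V → ℂ) :
    minorPoly (α.derivedWeight w).laplacian (fun y => a y.1) = minorPoly w.laplacian a *
      ∏ i : Fin k, minorPoly (α.repLaplacian w (ρ i.succ)) (fun y => a y.2) ^ f i.succ := by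
  refine Polynomial.funext fun x => ?_
  rw [eval_mul, eval_prod]
  simp only [eval_pow, eval_minorPoly]
  rw [α.laplacian_derivedWeight_add w a x, Matrix.det_submatrix_equiv_self,
    hρ.det_sum_translation_kronecker, Fin.prod_univ_succ]
  have h1 : ∀ i, (∑ g, ρ i g ⊗ₖ α.perturbedPart w a x g) = α.repLaplacian w (ρ i) +
      x • Matrix.diagonal fun y : Fin (f i) × V => a y.2 := fun i =>
    α.sum_kronecker_perturbedPart w (fun g => ρ i g) (map_one _) a x
  simp only [h1]
  rw [α.det_repLaplacian_add_of_trivial w (hρ.eq_one_of_trivial hρ0) (ρ 0) hρ0,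
    hρ.eq_one_of_trivial hρ0, pow_one]

end Cover

/-! ### First-order coefficients of products -/

section LinearCoefficient

open Polynomial

theorem coeff_two_mul (p q : ℂ[X]) :
    (p * q).coeff 2 = p.coeff 0 * q.coeff 2 + p.coeff 1 * q.coeff 1 + p.coeff 2 * q.coeff 0 := by
  rw [coeff_mul, Finset.Nat.sum_antidiagonal_eq_sum_range_succ_mk]
  simp [Finset.sum_range_succ]

/-- The quotient `coeff 1 / coeff 0` is the logarithmic derivative at `0`, hence additive on
products. -/
theorem coeff_one_div_mul {p q : ℂ[X]} (hp : p.coeff 0 ≠ 0) (hq : q.coeff 0 ≠ 0) :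
    (p * q).coeff 1 / (p * q).coeff 0 = p.coeff 1 / p.coeff 0 + q.coeff 1 / q.coeff 0 := by
  rw [mul_coeff_one, mul_coeff_zero]
  field_simp
  ring

theorem coeff_zero_pow_ne_zero {p : ℂ[X]} (hp : p.coeff 0 ≠ 0) (n : ℕ) :
    (p ^ n).coeff 0 ≠ 0 := by
  rw [coeff_zero_eq_eval_zero, eval_pow, ← coeff_zero_eq_eval_zero]
  exact pow_ne_zero n hp

theorem coeff_one_div_pow {p : ℂ[X]} (hp : p.coeff 0 ≠ 0) (n : ℕ) :
    (p ^ n).coeff 1 / (p ^ n).coeff 0 = n * (p.coeff 1 / p.coeff 0) := by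
  induction n with
  | zero => simp [coeff_one]
  | succ n ih =>
    rw [pow_succ, coeff_one_div_mul (coeff_zero_pow_ne_zero hp n) hp, ih]
    push_cast
    ring

theorem coeff_one_div_prod_pow {ι : Type*} (s : Finset ι) (p : ι → ℂ[X]) (f : ι → ℕ)
    (hp : ∀ i ∈ s, (p i).coeff 0 ≠ 0) :
    (∏ i ∈ s, p i ^ f i).coeff 1 / (∏ i ∈ s, p i ^ f i).coeff 0 =
      ∑ i ∈ s, f i * ((p i).coeff 1 / (p i).coeff 0) := by
  classical
  induction s using Finset.induction_on with
  | empty => simp [coeff_one]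
  | insert i s hi ih =>
    have h : (∏ j ∈ s, p j ^ f j).coeff 0 ≠ 0 := by
      rw [coeff_zero_prod]
      exact Finset.prod_ne_zero_iff.mpr fun j hj =>
        coeff_zero_pow_ne_zero (hp j (Finset.mem_insert_of_mem hj)) _
    have hi0 := hp i (Finset.mem_insert_self i s)
    rw [Finset.prod_insert hi, Finset.sum_insert hi,
      coeff_one_div_mul (coeff_zero_pow_ne_zero hi0 _) h, coeff_one_div_pow hi0,
      ih fun j hj => hp j (Finset.mem_insert_of_mem hj)]

end LinearCoefficient

/-! ### The determinants of the irreducible representations -/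

section RepDet

variable {V Γ : Type*} [Fintype V] [DecidableEq V] [Group Γ] [Fintype Γ]
  {G : SimpleGraph V} (α : Voltage G Γ) (w : SymmWeight G)
  {d : ℕ} (ρ : Γ →* Matrix (Fin d) (Fin d) ℂ)

/-- The matrix whose determinant is `repDet`. -/
def Voltage.repMatrix (u t : ℂ) : Matrix (Fin d × V) (Fin d × V) ℂ :=
  1 - t • (∑ g : Γ, ρ g ⊗ₖ α.part w g)
    + ((1 - u) * t ^ 2) •
      ((1 : Matrix (Fin d) (Fin d) ℂ) ⊗ₖ (w.degMatrix - (1 - u) • (1 : Matrix V V ℂ)))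

theorem Voltage.one_kronecker_degMatrix_sub (c : ℂ) :
    ((1 : Matrix (Fin d) (Fin d) ℂ) ⊗ₖ (w.degMatrix - c • (1 : Matrix V V ℂ))) =
      Matrix.diagonal fun y : Fin d × V => w.degree y.2 - c := by
  have h : w.degMatrix - c • (1 : Matrix V V ℂ) = Matrix.diagonal fun v => w.degree v - c := by
    rw [SymmWeight.degMatrix, ← Matrix.diagonal_one, ← Matrix.diagonal_smul, Matrix.diagonal_sub]
    simp
  rw [h, ← Matrix.diagonal_one, Matrix.diagonal_kronecker_diagonal]
  simp

theorem Voltage.repMatrix_apply (u t : ℂ) (i j : Fin d × V) :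
    α.repMatrix w ρ u t i j = (1 : Matrix (Fin d × V) (Fin d × V) ℂ) i j
      - t * (∑ g : Γ, ρ g ⊗ₖ α.part w g) i j
      + ((1 - u) * t ^ 2) * if i = j then w.degree i.2 - (1 - u) else 0 := by
  rw [Voltage.repMatrix, one_kronecker_degMatrix_sub]
  rfl

theorem Voltage.repLaplacian_apply (i j : Fin d × V) :
    α.repLaplacian w ρ i j = (if i = j then w.degree i.2 else 0)
      - (∑ g : Γ, ρ g ⊗ₖ α.part w g) i j := by
  have h := one_kronecker_degMatrix_sub (d := d) w 0
  rw [zero_smul, sub_zero] at h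
  rw [Voltage.repLaplacian, h]
  simp [Matrix.diagonal_apply]

/-- At this `u` one has `(1 - u) t² = t`, and the identity term cancels against `(1 - u) t = 1`. -/
theorem Voltage.repMatrix_eq_smul_repLaplacian {t : ℂ} (ht : t ≠ 0) :
    α.repMatrix w ρ (1 - 1 / t) t = t • α.repLaplacian w ρ := by
  ext i j
  rw [Matrix.smul_apply, repMatrix_apply, repLaplacian_apply, Matrix.one_apply, smul_eq_mul]
  by_cases h : i = j
  · simp only [if_pos h]
    field_simp
    ring
  · simp only [if_neg h]
    ring

theorem Voltage.repDet_eq {t : ℂ} (ht : t ≠ 0) :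
    α.repDet w ρ (1 - 1 / t) t = t ^ (d * Fintype.card V) * (α.repLaplacian w ρ).det := by
  have h : α.repDet w ρ (1 - 1 / t) t = (α.repMatrix w ρ (1 - 1 / t) t).det := rfl
  rw [h, α.repMatrix_eq_smul_repLaplacian w ρ ht, Matrix.det_smul]
  simp

/-- The factor `1 - u` enters twice, so the `u`-derivative of the matrix is `-t² D_w + 2t`, that is
`-t (t D_w - 2)`. This produces the vertex weights of the Kirchhoff index. -/
theorem Voltage.logDeriv_repDet_left {t : ℂ} (ht : t ≠ 0) :
    logDeriv (fun u => α.repDet w ρ u t) (1 - 1 / t) =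
      -((minorPoly (α.repLaplacian w ρ) fun y => w.degree y.2 * t - 2).coeff 1 /
        (α.repLaplacian w ρ).det) := by
  refine logDeriv_det_of_jet_smul_diagonal (B := fun u => α.repMatrix w ρ u t) ht
    (α.repMatrix_eq_smul_repLaplacian w ρ ht) fun i j => ?_
  simp only [repMatrix_apply, Matrix.diagonal_apply]
  by_cases h : i = j
  · simp only [if_pos h]
    have h1 : HasDerivAt (fun u : ℂ => 1 - u) (-1) (1 - 1 / t) :=
      (hasDerivAt_id _).const_sub 1
    refine (((h1.mul_const (t ^ 2)).mul (h1.const_sub (w.degree i.2))).const_add _).congr_deriv ?_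
    field_simp
    ring
  · simp only [if_neg h, mul_zero, add_zero]
    exact hasDerivAt_const _ _

theorem Voltage.logDeriv_repDet_right {t : ℂ} (ht : t ≠ 0)
    (hdet : (α.repLaplacian w ρ).det ≠ 0) :
    logDeriv (fun s => α.repDet w ρ (1 - 1 / t) s) t =
      (d * Fintype.card V : ℂ) / t +
        (minorPoly (α.repLaplacian w ρ) fun y => w.degree y.2 * t - 2).coeff 1 /
          (α.repLaplacian w ρ).det / t ^ 2 := by
  have h := logDeriv_det_of_jet_smul_add_diagonal (B := fun s => α.repMatrix w ρ (1 - 1 / t) s)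
    (a := fun y => w.degree y.2 * t - 2) ht hdet (α.repMatrix_eq_smul_repLaplacian w ρ ht) ?_
  · rw [Fintype.card_prod, Fintype.card_fin, Nat.cast_mul] at h
    exact h
  intro i j
  simp only [repMatrix_apply, repLaplacian_apply, Matrix.diagonal_apply]
  have h2 : HasDerivAt (fun y : ℂ => y ^ 2) (2 * t) t := by
    simpa using hasDerivAt_pow 2 t
  refine ((((hasDerivAt_id t).mul_const _).const_sub _).add
    ((h2.const_mul _).mul_const _)).congr_deriv ?_
  by_cases h : i = j
  · simp only [if_pos h]
    field_simp
    ring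
  · simp only [if_neg h]
    ring

end RepDet

/-! ### The Kirchhoff index of the covering -/

section CoverKirchhoff

open Polynomial

variable {V Γ : Type*} [Fintype V] [DecidableEq V] [Group Γ] [Fintype Γ] [DecidableEq Γ]
  {G : SimpleGraph V} (α : Voltage G Γ) (w : SymmWeight G) {k : ℕ} {f : Fin (k + 1) → ℕ}
  {ρ : (i : Fin (k + 1)) → Γ →* Matrix (Fin (f i)) (Fin (f i)) ℂ}

/-- Compare linear coefficients of the factorization for `a = 1`. As `det L = 0`, only the constant
terms of the twisted factors enter, and a common factor `|V|` cancels. -/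
theorem IsAllIrreps.card_mul_complexity_derivedWeight [Nonempty V] (hρ : IsAllIrreps ρ)
    (hρ0 : ∀ g, ρ 0 g = 1) :
    Fintype.card Γ * (α.derivedWeight w).complexity =
      w.complexity * ∏ i : Fin k, (α.repLaplacian w (ρ i.succ)).det ^ f i.succ := by
  have h := congrArg (fun p => p.coeff 1)
    (hρ.minorPoly_laplacian_derivedWeight α w hρ0 fun _ => 1)
  simp only [mul_coeff_one, coeff_zero_minorPoly, w.det_laplacian, zero_mul, zero_add,
    SymmWeight.coeff_one_minorPoly_laplacian, coeff_zero_prod] at h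
  simp only [coeff_zero_eq_eval_zero, eval_pow] at h
  simp only [← coeff_zero_eq_eval_zero, coeff_zero_minorPoly, Finset.sum_const, Finset.card_univ,
    nsmul_eq_mul, mul_one, Fintype.card_prod, Nat.cast_mul] at h
  have hV : (Fintype.card V : ℂ) ≠ 0 := Nat.cast_ne_zero.mpr Fintype.card_ne_zero
  exact mul_left_cancel₀ hV (by linear_combination h)

theorem IsAllIrreps.complexity_ne_zero [Nonempty V] (hρ : IsAllIrreps ρ) (hρ0 : ∀ g, ρ 0 g = 1)
    (hκ : (α.derivedWeight w).complexity ≠ 0) :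
    w.complexity ≠ 0 ∧ ∀ i : Fin k, (α.repLaplacian w (ρ i.succ)).det ≠ 0 := by
  have hcard : (Fintype.card Γ : ℂ) ≠ 0 := Nat.cast_ne_zero.mpr Fintype.card_ne_zero
  have h := mul_ne_zero hcard hκ
  rw [hρ.card_mul_complexity_derivedWeight α w hρ0] at h
  refine ⟨left_ne_zero_of_mul h, fun i hi => ?_⟩
  refine Finset.prod_ne_zero_iff.mp (right_ne_zero_of_mul h) i (Finset.mem_univ i) ?_
  rw [hi, zero_pow (hρ.degree_ne_zero _)]

/-- The Kirchhoff index of the covering in terms of the twisted Laplacians. -/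
theorem IsAllIrreps.kirchhoff_derivedWeight [Nonempty V] (hρ : IsAllIrreps ρ)
    (hρ0 : ∀ g, ρ 0 g = 1) (hκ : (α.derivedWeight w).complexity ≠ 0) (t : ℂ) :
    (α.derivedWeight w).kirchhoff t = Fintype.card Γ * w.kirchhoff t +
      2 * Fintype.card Γ * (w.total * t - Fintype.card V) * ∑ i : Fin k, (f i.succ : ℂ) *
        ((minorPoly (α.repLaplacian w (ρ i.succ)) fun y => w.degree y.2 * t - 2).coeff 1 /
          (α.repLaplacian w (ρ i.succ)).det) := by
  obtain ⟨hκ', hdet⟩ := hρ.complexity_ne_zero α w hρ0 hκ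
  have hcompl := hρ.card_mul_complexity_derivedWeight α w hρ0
  set H : ℂ[X] := ∏ i : Fin k, minorPoly (α.repLaplacian w (ρ i.succ))
    (fun y => w.degree y.2 * t - 2) ^ f i.succ with hH
  have hH0 : H.coeff 0 = ∏ i : Fin k, (α.repLaplacian w (ρ i.succ)).det ^ f i.succ := by
    rw [hH, coeff_zero_prod]
    simp only [coeff_zero_eq_eval_zero, eval_pow]
    simp only [← coeff_zero_eq_eval_zero, coeff_zero_minorPoly]
  have hH0' : H.coeff 0 ≠ 0 := by
    rw [hH0]
    exact Finset.prod_ne_zero_iff.mpr fun i _ => pow_ne_zero _ (hdet i)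
  have hH1 := coeff_one_div_prod_pow Finset.univ
    (fun i : Fin k => minorPoly (α.repLaplacian w (ρ i.succ)) fun y => w.degree y.2 * t - 2)
    (fun i => f i.succ) fun i _ => by rw [coeff_zero_minorPoly]; exact hdet i
  simp only [coeff_zero_minorPoly] at hH1
  rw [← hH, div_eq_iff hH0'] at hH1
  rw [← hH0] at hcompl
  have h2 := congrArg (fun p => p.coeff 2)
    (hρ.minorPoly_laplacian_derivedWeight α w hρ0 fun v => w.degree v * t - 2)
  have hdeg : (fun y : V × Γ => w.degree y.1 * t - 2) =
      fun y => (α.derivedWeight w).degree y * t - 2 := by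
    funext y
    rw [α.degree_derivedWeight w y]
  simp only [← hH] at h2
  rw [hdeg, SymmWeight.coeff_two_minorPoly_laplacian _ hκ, coeff_two_mul,
    coeff_zero_minorPoly, w.det_laplacian, SymmWeight.coeff_two_minorPoly_laplacian _ hκ',
    SymmWeight.coeff_one_minorPoly_laplacian, w.sum_degree_mul_sub, hH1] at h2
  -- Since `det L = 0`, `h2` expresses `κ̃ Kf̃` through `κ H(0)` alone. That factor equals `|Γ| κ̃`
  -- by `hcompl`, so `κ̃` cancels.
  refine mul_left_cancel₀ hκ ?_
  linear_combination h2 - (w.kirchhoff t + 2 * (w.total * t - Fintype.card V) *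
    ∑ i : Fin k, (f i.succ : ℂ) *
        ((minorPoly (α.repLaplacian w (ρ i.succ)) fun y => w.degree y.2 * t - 2).coeff 1 /
          (α.repLaplacian w (ρ i.succ)).det)) * hcompl

end CoverKirchhoff

end WeightedCover

end

theorem theorem16 {V Γ : Type*} [Fintype V] [DecidableEq V] [Group Γ] [Fintype Γ] [DecidableEq Γ]
    (G : SimpleGraph V) (_hG : G.Connected)
    (α : WeightedCover.Voltage G Γ) (w : WeightedCover.SymmWeight G)
    (k : ℕ) (f : Fin (k + 1) → ℕ)
    (ρ : (i : Fin (k + 1)) → Γ →* Matrix (Fin (f i)) (Fin (f i)) ℂ)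
    (_hρ : WeightedCover.IsAllIrreps ρ) (_hρ0 : ∀ g, ρ 0 g = 1)
    (_hconn : α.derived.Connected)
    (_hκ : (α.derivedWeight w).complexity ≠ 0)
    (t : ℂ) (_ht : t ≠ 0) :
    -- all the quotients and logarithmic derivatives below are defined
    w.complexity ≠ 0 ∧
    (∀ i : Fin k, α.repDet w (ρ i.succ) (1 - 1 / t) t ≠ 0) ∧
    -- (1)
    (α.derivedWeight w).kirchhoff t =
      Fintype.card Γ * w.kirchhoff t
        - 2 * Fintype.card Γ * (w.total * t - Fintype.card V) *
          (((Fintype.card Γ : ℂ) - 1) * Fintype.card V * t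
            - t ^ 2 * ∑ i : Fin k, (f i.succ : ℂ) *
                logDeriv (fun s => α.repDet w (ρ i.succ) (1 - 1 / t) s) t) ∧
    -- (2)
    (α.derivedWeight w).kirchhoff t =
      Fintype.card Γ * w.kirchhoff t
        + Fintype.card Γ * (Fintype.card V - w.total * t) *
          (((Fintype.card Γ : ℂ) - 1) * Fintype.card V * t
            - t ^ 2 * ∑ i : Fin k, (f i.succ : ℂ) *
                logDeriv (fun s => α.repDet w (ρ i.succ) (1 - 1 / t) s) t
            + ∑ i : Fin k, (f i.succ : ℂ) *
                logDeriv (fun u => α.repDet w (ρ i.succ) u t) (1 - 1 / t)) ∧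
    -- (3)
    (α.derivedWeight w).kirchhoff t =
      Fintype.card Γ * w.kirchhoff t
        - 2 * Fintype.card Γ * (w.total * t - Fintype.card V) *
          ∑ i : Fin k, (f i.succ : ℂ) *
            logDeriv (fun u => α.repDet w (ρ i.succ) u t) (1 - 1 / t) := by
  have : Nonempty V := _hG.nonempty
  obtain ⟨hκ, hdet⟩ := _hρ.complexity_ne_zero α w _hρ0 _hκ
  have hmain := _hρ.kirchhoff_derivedWeight α w _hρ0 _hκ t
  set c : Fin k → ℂ := fun i => (WeightedCover.minorPoly (α.repLaplacian w (ρ i.succ))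
    fun y => w.degree y.2 * t - 2).coeff 1 / (α.repLaplacian w (ρ i.succ)).det with hc
  -- The trivial representation accounts for the subtracted `1`.
  have hsq : ∑ i : Fin k, (f i.succ : ℂ) * f i.succ = Fintype.card Γ - 1 := by
    have h := _hρ.sum_sq_eq_card
    rw [Fin.sum_univ_succ, _hρ.eq_one_of_trivial _hρ0] at h
    rw [← h]
    simp
  have hu : ∑ i : Fin k, (f i.succ : ℂ) *
      logDeriv (fun u => α.repDet w (ρ i.succ) u t) (1 - 1 / t) =
        -∑ i : Fin k, (f i.succ : ℂ) * c i := by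
    rw [← Finset.sum_neg_distrib]
    refine Finset.sum_congr rfl fun i _ => ?_
    rw [α.logDeriv_repDet_left w (ρ i.succ) _ht, mul_neg]
  -- The terms `f_i n / t` come from the size `f_i n` of the matrix. Weighted by `f_i t²` they add
  -- up to `(|Γ| - 1) n t`, the correction in (1) and (2).
  have ht : t ^ 2 * ∑ i : Fin k, (f i.succ : ℂ) *
      logDeriv (fun s => α.repDet w (ρ i.succ) (1 - 1 / t) s) t =
        (Fintype.card Γ - 1) * Fintype.card V * t + ∑ i : Fin k, (f i.succ : ℂ) * c i := by
    rw [← hsq, Finset.mul_sum, Finset.sum_mul, Finset.sum_mul, ← Finset.sum_add_distrib]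
    refine Finset.sum_congr rfl fun i _ => ?_
    rw [α.logDeriv_repDet_right w (ρ i.succ) _ht (hdet i)]
    change _ = _ + (f i.succ : ℂ) * (_ / _)
    field_simp
  refine ⟨hκ, fun i => ?_, ?_, ?_, ?_⟩
  · rw [α.repDet_eq w (ρ i.succ) _ht]
    exact mul_ne_zero (pow_ne_zero _ _ht) (hdet i)
  · rw [hmain, ht]
    ring
  · rw [hmain, ht, hu]
    ring
  · rw [hmain, hu]
    ring
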